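/- Let $n\ge 2$, let $B_1$ be the open unit ball of $\mathbb{R}^n$, and let $V:[0,1]\to\mathbb{R}$ be such that $V\ge 0$, $V\not\equiv 0$ and $x\mapsto V(|x|)$ is smooth ($C^\infty$) on $\overline{B_1}$. Let $G(r,s)$, for $r\in[0,1]$ and $s\in(0,1)$, be the Green function of the operator $$\mathcal{L}u=-u''-\frac{n-1}{r}u'+V(r)u \quad\text{on }(0,1),\qquad u'(0)=0,\quad u'(1)=0,$$ that is, $G(\cdot,s)$ is continuous on $[0,1]$, is of class $C^2$ with $\mathcal{L}G(\cdot,s)=0$ on $(0,1)\setminus\{s\}$, satisfies the two boundary conditions, and its derivative in the first variable has one-sided limits at $s$ with $\partial_rG(s^+,s)-\partial_rG(s^-,s)=-1$ (so $\mathcal{L}G(\cdot,s)=\delta_s$). Put $G(r,1)=\lim_{s\to1^-}G(r,s)$ for $r\in[0,1]$. Then this Green function exists, including the limits defining $G(\cdot,1)$, one has $G(r,r)>0$ for $r\in(0,1]$, and with $$F(r)=\frac{|\partial B_1|\,r^{n-1}}{G(r,r)},\qquad r\in(0,1],$$ where $|\partial B_1|$ is the surface measure of the unit sphere, the following hold.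 (i) $\lim_{r\to1^-}F'(r)$ exists and is negative, and $r=1$ is a local minimum point of $F$ on $(0,1]$. (ii) For all sufficiently large real $p$ there is a radial classical solution $u_p\in C^2(\overline{B_1})$ of the Neumann problem $$-\Delta u+V(|x|)u=u^p\ \text{ in }B_1,\qquad u>0\ \text{ in }B_1,\qquad \frac{\partial u}{\partial\nu}=0\ \text{ on }\partial B_1,$$ such that, as $p\to+\infty$, $$u_p(x)\to\frac{G(|x|,1)}{G(1,1)}\quad\text{in }H^1(B_1)\text{ and in }L^\infty(B_1).$$ -/

import Mathlib

open MeasureTheory Filter Topology Set Metric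
open scoped ContDiff ENNReal

/-- The Euclidean space of dimension `n`. -/
abbrev Euc (n : ℕ) : Type := EuclideanSpace ℝ (Fin n)

/-- The Green function `G(r,s)` of `L u = -u'' - (n-1)/r u' + V(r) u` on `(0,1)` with
`u'(0) = 0` and `u'(1) = 0`. For `s ∈ (0,1)` the function `G(·,s)` is continuous on `[0,1]`,
solves `L u = 0` classically away from `s`, has a jump `-1` of its derivative at `s`
(so that `L G(·,s) = δ_s`), and satisfies both boundary conditions.
For `s = 1`, `G(·,1)` is the pointwise limit of `G(·,s)` as `s → 1⁻`. -/
structure IsNeumannGreen (n : ℕ) (V : ℝ → ℝ) (G : ℝ → ℝ → ℝ) : Prop where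
  continuousOn : ∀ s ∈ Ioo (0 : ℝ) 1, ContinuousOn (fun r => G r s) (Icc 0 1)
  contDiffOn : ∀ s ∈ Ioo (0 : ℝ) 1, ContDiffOn ℝ 2 (fun r => G r s) (Ioo 0 1 \ {s})
  equation : ∀ s ∈ Ioo (0 : ℝ) 1, ∀ r ∈ Ioo (0 : ℝ) 1 \ {s},
    -deriv (deriv fun t => G t s) r - ((n : ℝ) - 1) / r * deriv (fun t => G t s) r
      + V r * G r s = 0
  jump : ∀ s ∈ Ioo (0 : ℝ) 1, ∃ a b : ℝ,
    Tendsto (deriv fun t => G t s) (𝓝[<] s) (𝓝 a) ∧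
    Tendsto (deriv fun t => G t s) (𝓝[>] s) (𝓝 b) ∧ b - a = -1
  deriv_zero : ∀ s ∈ Ioo (0 : ℝ) 1, HasDerivWithinAt (fun r => G r s) 0 (Icc 0 1) 0
  deriv_one : ∀ s ∈ Ioo (0 : ℝ) 1, HasDerivWithinAt (fun r => G r s) 0 (Icc 0 1) 1
  tendsto_one : ∀ r ∈ Icc (0 : ℝ) 1, Tendsto (fun s => G r s) (𝓝[<] 1) (𝓝 (G r 1))

/-- `|∂B_1|`, the surface measure of the unit sphere of `ℝⁿ`. -/
noncomputable def sphereArea (n : ℕ) : ℝ :=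
  (Measure.toSphere (volume : Measure (Euc n))).real univ

/-- `F(r) = |∂B_1| r^{n-1} / G(r,r)`. -/
noncomputable def energyF (n : ℕ) (G : ℝ → ℝ → ℝ) (r : ℝ) : ℝ :=
  sphereArea n * r ^ (n - 1) / G r r

/-- `u` is a classical positive solution of `-Δu + V(|x|) u = u^p` in `B_1` with
`∂u/∂ν = 0` on `∂B_1`; at a boundary point `x` the outer normal is `x` itself. -/
structure IsNeumannSolution (n : ℕ) (V : ℝ → ℝ) (p : ℝ) (u : Euc n → ℝ) : Prop where
  contDiffOn : ContDiffOn ℝ 2 u (closedBall 0 1)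
  equation : ∀ x ∈ ball (0 : Euc n) 1,
    -Laplacian.laplacian u x + V ‖x‖ * u x = u x ^ p
  pos : ∀ x ∈ ball (0 : Euc n) 1, 0 < u x
  neumann : ∀ x ∈ sphere (0 : Euc n) 1, fderivWithin ℝ u (closedBall 0 1) x x = 0

/-- `u ∈ H¹(Ω)` with weak gradient `g`. -/
structure HasH1Gradient {n : ℕ} (Ω : Set (Euc n)) (u : Euc n → ℝ) (g : Euc n → Euc n) :
    Prop where
  memLp : MemLp u 2 (volume.restrict Ω)
  memLp_grad : MemLp g 2 (volume.restrict Ω)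
  weak : ∀ φ : Euc n → ℝ, ContDiff ℝ ∞ φ → HasCompactSupport φ → tsupport φ ⊆ Ω →
    ∀ v : Euc n, ∫ x in Ω, u x * fderiv ℝ φ x v = -∫ x in Ω, inner ℝ (g x) v * φ x

/-- `u_i → w` in `H¹(Ω)` along the filter `l`. -/
def TendstoInH1 {n : ℕ} {ι : Type*} (Ω : Set (Euc n)) (l : Filter ι)
    (u : ι → Euc n → ℝ) (w : Euc n → ℝ) : Prop :=
  ∃ (D : ι → Euc n → Euc n) (Dw : Euc n → Euc n),
    HasH1Gradient Ω w Dw ∧ (∀ᶠ i in l, HasH1Gradient Ω (u i) (D i)) ∧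
    Tendsto (fun i => eLpNorm (u i - w) 2 (volume.restrict Ω)) l (𝓝 0) ∧
    Tendsto (fun i => eLpNorm (D i - Dw) 2 (volume.restrict Ω)) l (𝓝 0)

/-- `u_i → w` in `L^∞(Ω)` along the filter `l`. -/
def TendstoInLinfty {n : ℕ} {ι : Type*} (Ω : Set (Euc n)) (l : Filter ι)
    (u : ι → Euc n → ℝ) (w : Euc n → ℝ) : Prop :=
  MemLp w ∞ (volume.restrict Ω) ∧ (∀ᶠ i in l, MemLp (u i) ∞ (volume.restrict Ω)) ∧
    Tendsto (fun i => eLpNorm (u i - w) ∞ (volume.restrict Ω)) l (𝓝 0)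

/-! Write d = n - 1 and let φ be the regular solution of φ'' + (d/r)φ' = Vφ with φ(1) = 1. As V ≥ 0
is not identically zero, φ is positive and nondecreasing, and m = φ'(1) > 0. Reduction of order
gives a second solution ψ with ψ'(1) = 0, and G(r,s) = s^d φ(min) ψ(max). Any Green function equals
this one for s in (0,1]: since d ≥ 1, boundedness at 0 selects φ; the condition at 1 selects ψ;
continuity and the jump fix the factors. Hence G(·,1)/G(1,1) = φ and F = |∂B_1|/(φψ), whose
derivative tends to -|∂B_1| m² < 0 at 1 (`tendsto_deriv_energyF`). This is (i).

For (ii) one shoots from the origin with u(0) = αφ(0), u'(0) = 0. The flux W = r^d(uφ' - u'φ)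
satisfies W' = r^d φ u^p ≥ 0 and (u/φ)' = -W/(r^d φ²), so u/φ decreases from α, and u follows αφ as
long as u^p is small. Let u be nondecreasing on a fixed layer [r₁,1]. Then W(1) is bounded, which
bounds the mass of u^p (`mass_le`). The energy r^{2d}(u'²/2 + u^{p+1}/(p+1)) is nondecreasing there,
so either u' is bounded below or u^p is of order p (`slope_or_large`). Together these force u(1) ≤ 1
+ o(1), concentration of u^p at r = 1, and u(1) ≥ α - o(1).

The minimum of u' over [r₁,1] depends continuously on α. It is nonnegative at α = 1 - ε₀, where u^p
is negligible, and cannot be positive at α = 1 + ε₀, where u(1) would be too large; so it vanishes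
for some α between. At an interior zero of u' one would have u'' = 0, hence u^p = Vu, which is
bounded, against the order p given by the energy (`eventually_zero_eq_one`). So the zero lies at r =
1: this is a Neumann solution. Uniform closeness of u/φ to 1 gives L^∞ convergence; gradients are
bounded and converge away from the boundary, which gives H¹ convergence. -/

/-- The weighted radial average `∫₀¹ σ^d h(tσ) dσ`. -/
noncomputable def radAvg (d : ℕ) (h : ℝ → ℝ) (t : ℝ) : ℝ :=
  ∫ σ in (0 : ℝ)..1, σ ^ d * h (t * σ)

/-- The radial potential: the function vanishing at `0` that solves
`y'' + (d / r) y' = h`, `y'(0) = 0`. -/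
noncomputable def radPot (d : ℕ) (h : ℝ → ℝ) (r : ℝ) : ℝ :=
  ∫ t in (0 : ℝ)..r, t * radAvg d h t

/-! ### Calculus of radial averages and potentials -/

section RadialCalculus

variable {d : ℕ} {h : ℝ → ℝ}

theorem continuous_radAvg (hh : Continuous h) : Continuous (radAvg d h) := by
  unfold radAvg
  exact intervalIntegral.continuous_parametric_intervalIntegral_of_continuous'
    (f := fun t σ => σ ^ d * h (t * σ)) (by fun_prop) 0 1

theorem hasDerivAt_radPot (hh : Continuous h) (t : ℝ) :
    HasDerivAt (radPot d h) (t * radAvg d h t) t := by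
  have hc : Continuous fun t => t * radAvg d h t := continuous_id.mul (continuous_radAvg hh)
  exact intervalIntegral.integral_hasDerivAt_right (hc.intervalIntegrable _ _)
    hc.stronglyMeasurable.stronglyMeasurableAtFilter hc.continuousAt

theorem radPot_zero : radPot d h 0 = 0 := by simp [radPot]

theorem radAvg_zero : radAvg d h 0 = h 0 / (d + 1) := by
  simp [radAvg, integral_pow, div_eq_inv_mul]

/-- Substitute s = tσ. With y = `radPot d h`, the left side is t^d y'(t), so this is the integrated
divergence form (t^d y')' = t^d h; the average over [0,1] keeps y' regular at the origin. -/
theorem pow_mul_radAvg (t : ℝ) :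
    t ^ (d + 1) * radAvg d h t = ∫ s in (0 : ℝ)..t, s ^ d * h s := by
  have := intervalIntegral.mul_integral_comp_mul_left (a := 0) (b := 1)
    (f := fun s => s ^ d * h s) t
  simp only [mul_zero, mul_one] at this
  rw [← this, radAvg, pow_succ, mul_right_comm, ← intervalIntegral.integral_const_mul, mul_comm]
  congr 1
  apply intervalIntegral.integral_congr
  intro σ _
  simp only [mul_pow]
  ring

theorem hasDerivAt_pow_mul_radAvg (hh : Continuous h) (t : ℝ) :
    HasDerivAt (fun t => t ^ (d + 1) * radAvg d h t) (t ^ d * h t) t := by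
  have hc : Continuous fun s => s ^ d * h s := by fun_prop
  have := intervalIntegral.integral_hasDerivAt_right (hc.intervalIntegrable 0 t)
    hc.stronglyMeasurable.stronglyMeasurableAtFilter hc.continuousAt
  exact this.congr_of_eventuallyEq (Eventually.of_forall fun t => pow_mul_radAvg t)

theorem hasDerivAt_radAvg (hh : Continuous h) {t : ℝ} (ht : t ≠ 0) :
    HasDerivAt (radAvg d h) ((h t - (d + 1) * radAvg d h t) / t) t := by
  have h1 := (hasDerivAt_pow_mul_radAvg (d := d) hh t).div (hasDerivAt_pow (d + 1) t)
    (pow_ne_zero _ ht)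
  refine (h1.congr_of_eventuallyEq ?_).congr_deriv ?_
  · filter_upwards [isOpen_ne.mem_nhds ht] with s hs
    have : s ^ (d + 1) ≠ 0 := pow_ne_zero _ hs
    simp only [Pi.div_apply]
    field_simp
  · simp only [Nat.add_sub_cancel]
    push_cast
    field_simp
    ring

theorem continuous_radPot (hh : Continuous h) : Continuous (radPot d h) :=
  continuous_iff_continuousAt.2 fun t => (hasDerivAt_radPot hh t).continuousAt

theorem abs_radAvg_le {t M : ℝ} (ht : 0 ≤ t)
    (hM : ∀ s ∈ Icc 0 t, |h s| ≤ M) : |radAvg d h t| ≤ M := by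
  have hM0 : 0 ≤ M := (abs_nonneg _).trans (hM 0 ⟨le_rfl, ht⟩)
  have := intervalIntegral.norm_integral_le_of_norm_le_const (a := 0) (b := 1) (C := M)
    (f := fun σ => σ ^ d * h (t * σ)) ?_
  · simpa [radAvg] using this
  · intro σ hσ
    rw [uIoc_of_le zero_le_one] at hσ
    rw [norm_mul, Real.norm_eq_abs, Real.norm_eq_abs, abs_pow, abs_of_pos hσ.1]
    have h1 := hM (t * σ) ⟨mul_nonneg ht hσ.1.le, mul_le_of_le_one_right ht hσ.2⟩
    have h2 : σ ^ d ≤ 1 := pow_le_one₀ hσ.1.le hσ.2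
    nlinarith [abs_nonneg (h (t * σ)), pow_nonneg hσ.1.le d]

theorem radAvg_sub {h₁ h₂ : ℝ → ℝ} (c₁ : Continuous h₁) (c₂ : Continuous h₂) (t : ℝ) :
    radAvg d h₁ t - radAvg d h₂ t = radAvg d (fun s => h₁ s - h₂ s) t := by
  unfold radAvg
  rw [← intervalIntegral.integral_sub]
  · simp only [mul_sub]
  · exact Continuous.intervalIntegrable (by fun_prop) _ _
  · exact Continuous.intervalIntegrable (by fun_prop) _ _

theorem radPot_sub {h₁ h₂ : ℝ → ℝ} (c₁ : Continuous h₁) (c₂ : Continuous h₂) (t : ℝ) :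
    radPot d h₁ t - radPot d h₂ t = radPot d (fun s => h₁ s - h₂ s) t := by
  have e₁ := continuous_radAvg (d := d) c₁
  have e₂ := continuous_radAvg (d := d) c₂
  unfold radPot
  rw [← intervalIntegral.integral_sub]
  · simp only [← mul_sub, radAvg_sub c₁ c₂]
  · exact Continuous.intervalIntegrable (by fun_prop) _ _
  · exact Continuous.intervalIntegrable (by fun_prop) _ _

theorem radAvg_const_mul (c t : ℝ) :
    radAvg d (fun s => c * h s) t = c * radAvg d h t := by
  unfold radAvg
  rw [← intervalIntegral.integral_const_mul]
  congr 1
  ext σ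
  ring

theorem radPot_const_mul (c t : ℝ) :
    radPot d (fun s => c * h s) t = c * radPot d h t := by
  unfold radPot
  rw [← intervalIntegral.integral_const_mul]
  congr 1
  ext σ
  rw [radAvg_const_mul]
  ring

theorem radAvg_nonneg {t : ℝ} (ht : 0 ≤ t) (h0 : ∀ s ∈ Icc 0 t, 0 ≤ h s) :
    0 ≤ radAvg d h t := by
  refine intervalIntegral.integral_nonneg zero_le_one fun σ hσ => ?_
  exact mul_nonneg (pow_nonneg hσ.1 _)
    (h0 _ ⟨mul_nonneg ht hσ.1, mul_le_of_le_one_right ht hσ.2⟩)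

theorem radPot_nonneg {t : ℝ} (ht : 0 ≤ t) (h0 : ∀ s ∈ Icc 0 t, 0 ≤ h s) :
    0 ≤ radPot d h t :=
  intervalIntegral.integral_nonneg ht fun _ hr => mul_nonneg hr.1
    (radAvg_nonneg hr.1 fun s hs => h0 s ⟨hs.1, hs.2.trans hr.2⟩)

/-- Integrating the weight exp(cs) gains a factor 1/c; this makes the Picard map a contraction on
all of [0,1] in a weighted sup norm. -/
theorem abs_radPot_le_exp (hh : Continuous h) {c M t : ℝ} (hc : 0 < c)
    (ht : t ∈ Icc (0 : ℝ) 1) (hM : ∀ s ∈ Icc (0 : ℝ) 1, |h s| ≤ M * Real.exp (c * s)) :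
    |radPot d h t| ≤ M / c * Real.exp (c * t) := by
  have hM0 : 0 ≤ M := by
    have := (abs_nonneg _).trans (hM 0 ⟨le_rfl, zero_le_one⟩)
    simpa using this
  have e₁ := continuous_radAvg (d := d) hh
  have h1 : |radPot d h t| ≤ ∫ s in (0 : ℝ)..t, M * Real.exp (c * s) := by
    unfold radPot
    rw [← Real.norm_eq_abs]
    refine intervalIntegral.norm_integral_le_of_norm_le ht.1 ?_
      (Continuous.intervalIntegrable (by fun_prop) _ _)
    refine Eventually.of_forall fun s hs => ?_
    have hs1 : s ≤ 1 := hs.2.trans ht.2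
    have h2 : |radAvg d h s| ≤ M * Real.exp (c * s) := by
      refine abs_radAvg_le hs.1.le fun x hx => (hM x ⟨hx.1, hx.2.trans hs1⟩).trans ?_
      gcongr
      exact hx.2
    rw [Real.norm_eq_abs, abs_mul, abs_of_pos hs.1]
    nlinarith [abs_nonneg (radAvg d h s), hs.1]
  refine h1.trans ?_
  have h3 : ∫ s in (0 : ℝ)..t, M * Real.exp (c * s)
      = M / c * Real.exp (c * t) - M / c * Real.exp (c * 0) := by
    apply intervalIntegral.integral_eq_sub_of_hasDerivAt
      (f := fun s => M / c * Real.exp (c * s))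
    · intro x _
      have := (((hasDerivAt_id x).const_mul c).exp).const_mul (M / c)
      refine this.congr_deriv ?_
      simp only [id]
      field_simp
    · exact Continuous.intervalIntegrable (by fun_prop) _ _
  rw [h3]
  have : 0 ≤ M / c * Real.exp (c * 0) := by positivity
  linarith

end RadialCalculus

/-! ### The singular initial value problem -/

/-- Solvability of the singular initial value problem `y'' + (d / r) y' = g(r, y)`, `y(0) = a`,
`y'(0) = 0` on `[0,1]` for a Lipschitz nonlinearity; the source `h a` is the right-hand side along
the solution, and depends on the initial value in a Lipschitz way. -/
theorem exists_radial_ivp (d : ℕ) (g : ℝ → ℝ → ℝ) (hg : Continuous fun x : ℝ × ℝ => g x.1 x.2)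
    (L : ℝ) (hL : ∀ s ∈ Icc (0 : ℝ) 1, ∀ x y, |g s x - g s y| ≤ L * |x - y|) :
    ∃ h : ℝ → ℝ → ℝ, ∃ C : ℝ, (∀ a, Continuous (h a)) ∧
      (∀ a, ∀ r ∈ Icc (0 : ℝ) 1, h a r = g r (a + radPot d (h a) r)) ∧
      ∀ a b, ∀ r ∈ Icc (0 : ℝ) 1, |h a r - h b r| ≤ C * |a - b| := by
  have hL0 : 0 ≤ L := by
    have := (abs_nonneg _).trans (hL 0 ⟨le_rfl, zero_le_one⟩ 1 0)
    simpa using this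
  set c : ℝ := 2 * L + 1 with hc
  have hc0 : 0 < c := by positivity
  -- The unknown is z(r) = exp(-cr) y(r), so the plain sup norm of z is the weighted norm of y. With
  -- c = 2L + 1 the contraction ratio L/c is below 1/2.
  let src : C(Icc (0 : ℝ) 1, ℝ) → ℝ → ℝ := fun z s =>
    g s (Real.exp (c * s) * z (projIcc 0 1 zero_le_one s))
  have hsrc : ∀ z, Continuous (src z) := by
    intro z
    have h1 : Continuous fun s : ℝ => (s, Real.exp (c * s) * z (projIcc 0 1 zero_le_one s)) := by
      have := z.continuous.comp (continuous_projIcc (a := (0:ℝ)) (b := 1) (h := zero_le_one))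
      exact continuous_id.prodMk (Continuous.mul (by fun_prop) this)
    exact hg.comp h1
  let T : ℝ → C(Icc (0 : ℝ) 1, ℝ) → C(Icc (0 : ℝ) 1, ℝ) := fun a z =>
    ⟨fun r => Real.exp (-(c * r)) * (a + radPot d (src z) r), by
      have := continuous_radPot (d := d) (hsrc z)
      fun_prop⟩
  have hdiff : ∀ z z' : C(Icc (0 : ℝ) 1, ℝ), ∀ s ∈ Icc (0 : ℝ) 1,
      |src z s - src z' s| ≤ L * dist z z' * Real.exp (c * s) := by
    intro z z' s hs
    refine (hL s hs _ _).trans ?_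
    rw [← mul_sub, abs_mul, abs_of_pos (Real.exp_pos _), mul_assoc, mul_comm (dist z z')]
    gcongr
    exact ContinuousMap.dist_apply_le_dist (f := z) (g := z') _
  have hT : ∀ a, ContractingWith (1 / 2) (T a) := by
    intro a
    refine ⟨by rw [← NNReal.coe_lt_coe]; norm_num, LipschitzWith.of_dist_le_mul fun z z' => ?_⟩
    rw [ContinuousMap.dist_le (by positivity)]
    intro r
    have hb := abs_radPot_le_exp (d := d) (h := fun s => src z s - src z' s)
      ((hsrc z).sub (hsrc z')) hc0 r.2 (hdiff z z')
    rw [← radPot_sub (hsrc z) (hsrc z')] at hb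
    change |Real.exp (-(c * r)) * (a + radPot d (src z) r)
      - Real.exp (-(c * r)) * (a + radPot d (src z') r)| ≤ _
    rw [← mul_sub, add_sub_add_left_eq_sub, abs_mul, abs_of_pos (Real.exp_pos _)]
    calc _ ≤ Real.exp (-(c * r)) * (L * dist z z' / c * Real.exp (c * r)) := by gcongr
      _ = L * dist z z' / c * (Real.exp (-(c * r)) * Real.exp (c * r)) := by ring
      _ = L * dist z z' / c := by rw [← Real.exp_add]; simp
      _ ≤ _ := by
        rw [div_le_iff₀ hc0]
        push_cast
        nlinarith [dist_nonneg (x := z) (y := z')]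
  let Z : ℝ → C(Icc (0 : ℝ) 1, ℝ) := fun a => ContractingWith.fixedPoint (T a) (hT a)
  have hZ : ∀ a, T a (Z a) = Z a := fun a => (hT a).fixedPoint_isFixedPt
  refine ⟨fun a => src (Z a), L * 2 * Real.exp c, fun a => hsrc _, ?_, ?_⟩
  · intro a r hr
    have h1 : (T a (Z a)) ⟨r, hr⟩ = Z a ⟨r, hr⟩ := by rw [hZ]
    change Real.exp (-(c * r)) * (a + radPot d (src (Z a)) r) = Z a ⟨r, hr⟩ at h1
    change g r _ = _
    congr 1
    rw [projIcc_of_mem zero_le_one hr, ← h1, ← mul_assoc, ← Real.exp_add]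
    simp
  · intro a b r hr
    have hab : dist (Z a) (Z b) ≤ |a - b| / (1 - (1 / 2 : NNReal)) := by
      refine (hT a).dist_fixedPoint_fixedPoint_of_dist_le' (T b) (hT a).fixedPoint_isFixedPt
        (hT b).fixedPoint_isFixedPt fun z => ?_
      rw [ContinuousMap.dist_le (abs_nonneg _)]
      intro r
      change |Real.exp (-(c * r)) * (a + radPot d (src z) r)
        - Real.exp (-(c * r)) * (b + radPot d (src z) r)| ≤ _
      rw [← mul_sub, add_sub_add_right_eq_sub, abs_mul, abs_of_pos (Real.exp_pos _)]
      refine mul_le_of_le_one_left (abs_nonneg _) (Real.exp_le_one_iff.2 ?_)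
      have := mul_nonneg hc0.le r.2.1
      linarith
    have hab' : dist (Z a) (Z b) ≤ 2 * |a - b| := by
      refine hab.trans (le_of_eq ?_)
      push_cast
      ring
    calc _ ≤ L * dist (Z a) (Z b) * Real.exp (c * r) := hdiff _ _ r hr
      _ ≤ L * (2 * |a - b|) * Real.exp (c * 1) := by
        gcongr
        exact hr.2
      _ = _ := by ring_nf

/-! ### The linear profile φ -/

/-- `φ` is the solution of `φ'' + (d / r) φ' = V φ`, `φ'(0) = 0`, normalised by `φ(1) = 1`;
`k` is a continuous extension of `V φ` to the line. -/
structure IsProfile (d : ℕ) (V φ k : ℝ → ℝ) : Prop where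
  cont : Continuous k
  eq : ∀ r, φ r = φ 0 + radPot d k r
  source : ∀ r ∈ Icc (0 : ℝ) 1, k r = V r * φ r
  nonneg : ∀ r ∈ Icc (0 : ℝ) 1, 0 ≤ V r
  pos : ∀ r ∈ Icc (0 : ℝ) 1, 0 < φ r
  one : φ 1 = 1
  slope_pos : 0 < radAvg d k 1

namespace IsProfile

variable {d : ℕ} {V φ k : ℝ → ℝ}

theorem hasDerivAt (P : IsProfile d V φ k) (r : ℝ) : HasDerivAt φ (r * radAvg d k r) r := by
  have := (hasDerivAt_radPot (d := d) P.cont r).const_add (φ 0)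
  exact this.congr_of_eventuallyEq (Eventually.of_forall P.eq)

theorem continuous (P : IsProfile d V φ k) : Continuous φ :=
  continuous_iff_continuousAt.2 fun r => (P.hasDerivAt r).continuousAt

theorem zero_pos (P : IsProfile d V φ k) : 0 < φ 0 := P.pos 0 ⟨le_rfl, zero_le_one⟩

theorem source_nonneg (P : IsProfile d V φ k) {r : ℝ} (hr : r ∈ Icc (0 : ℝ) 1) : 0 ≤ k r := by
  rw [P.source r hr]
  exact mul_nonneg (P.nonneg r hr) (P.pos r hr).le

theorem radAvg_nonneg (P : IsProfile d V φ k) {r : ℝ} (hr : r ∈ Icc (0 : ℝ) 1) :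
    0 ≤ radAvg d k r :=
  _root_.radAvg_nonneg hr.1 fun _ hs => P.source_nonneg ⟨hs.1, hs.2.trans hr.2⟩

theorem monotoneOn (P : IsProfile d V φ k) : MonotoneOn φ (Icc 0 1) := by
  refine monotoneOn_of_deriv_nonneg (convex_Icc 0 1) P.continuous.continuousOn
    (fun x _ => (P.hasDerivAt x).differentiableAt.differentiableWithinAt) fun x hx => ?_
  rw [interior_Icc] at hx
  rw [(P.hasDerivAt x).deriv]
  exact mul_nonneg hx.1.le (P.radAvg_nonneg ⟨hx.1.le, hx.2.le⟩)

theorem le_one (P : IsProfile d V φ k) {r : ℝ} (hr : r ∈ Icc (0 : ℝ) 1) : φ r ≤ 1 :=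
  P.one ▸ P.monotoneOn hr ⟨zero_le_one, le_rfl⟩ hr.2

theorem zero_le (P : IsProfile d V φ k) {r : ℝ} (hr : r ∈ Icc (0 : ℝ) 1) : φ 0 ≤ φ r :=
  P.monotoneOn ⟨le_rfl, zero_le_one⟩ hr hr.1

end IsProfile

theorem continuous_projIcc_comp {V : ℝ → ℝ} (hV : ContinuousOn V (Icc 0 1)) :
    Continuous fun r => V (projIcc (0 : ℝ) 1 zero_le_one r) :=
  (continuousOn_iff_continuous_domRestrict.1 hV).comp continuous_projIcc

/-- The equation is first solved with Vy replaced by V max(y,0): the source is then nonnegative, so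
y ≥ y(0) = 1 and the positive part disappears. Dividing by y(1) normalises. -/
theorem exists_isProfile (d : ℕ) {V : ℝ → ℝ} (hV : ContinuousOn V (Icc 0 1))
    (h0 : ∀ r ∈ Icc (0 : ℝ) 1, 0 ≤ V r) (hne : ∃ r ∈ Icc (0 : ℝ) 1, V r ≠ 0) :
    ∃ φ k, IsProfile d V φ k := by
  obtain ⟨L, hL⟩ := isCompact_Icc.exists_bound_of_continuousOn hV
  have hVc := continuous_projIcc_comp hV
  obtain ⟨h, -, hc, heq, -⟩ := exists_radial_ivp d
    (fun s x => V (projIcc (0 : ℝ) 1 zero_le_one s) * max x 0)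
    ((hVc.comp continuous_fst).mul (continuous_snd.max continuous_const)) L (by
      intro s hs x y
      rw [projIcc_of_mem zero_le_one hs, ← mul_sub, abs_mul]
      exact mul_le_mul (hL s hs) (abs_max_sub_max_le_abs x y 0) (abs_nonneg _)
        ((norm_nonneg _).trans (hL s hs)))
  have hk0 : ∀ r ∈ Icc (0 : ℝ) 1, 0 ≤ h 1 r := by
    intro r hr
    rw [heq 1 r hr, projIcc_of_mem zero_le_one hr]
    exact mul_nonneg (h0 r hr) (le_max_right _ _)
  set y : ℝ → ℝ := fun r => 1 + radPot d (h 1) r with hy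
  have hy1 : ∀ r ∈ Icc (0 : ℝ) 1, 1 ≤ y r := by
    intro r hr
    have := radPot_nonneg (d := d) hr.1 fun s hs => hk0 s ⟨hs.1, hs.2.trans hr.2⟩
    simp only [hy]
    linarith
  have hk : ∀ r ∈ Icc (0 : ℝ) 1, h 1 r = V r * y r := by
    intro r hr
    have h1 := hy1 r hr
    rw [heq 1 r hr, projIcc_of_mem zero_le_one hr]
    simp only
    rw [max_eq_left]
    simp only [hy] at h1
    linarith
  have hone : (1 : ℝ) ∈ Icc (0 : ℝ) 1 := ⟨zero_le_one, le_rfl⟩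
  have hyp : 0 < y 1 := by linarith [hy1 1 hone]
  refine ⟨fun r => (y 1)⁻¹ * y r, fun r => (y 1)⁻¹ * h 1 r, ?_, ?_, ?_, h0, ?_, ?_, ?_⟩
  · exact (hc 1).const_mul _
  · intro r
    rw [radPot_const_mul]
    simp only [hy, radPot_zero]
    ring
  · intro r hr
    rw [hk r hr]
    ring
  · intro r hr
    have := hy1 r hr
    positivity
  · exact inv_mul_cancel₀ hyp.ne'
  · rw [radAvg_const_mul]
    refine mul_pos (inv_pos.2 hyp) ?_
    obtain ⟨r, hr, hVr⟩ := hne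
    have hcont : ContinuousOn (fun σ => σ ^ d * h 1 (1 * σ)) (Icc 0 1) := by
      have := hc 1
      fun_prop
    have hnn : ∀ σ ∈ Ioc (0 : ℝ) 1, 0 ≤ σ ^ d * h 1 (1 * σ) := fun σ hσ => by
      rw [one_mul]
      exact mul_nonneg (pow_nonneg hσ.1.le _) (hk0 σ ⟨hσ.1.le, hσ.2⟩)
    -- The point where V is nonzero may be an endpoint; continuity of the source moves it inside,
    -- where the weight σ^d is positive.
    have hpos : ∃ c ∈ Ioo (0 : ℝ) 1, 0 < h 1 c := by
      have hr0 : 0 < h 1 r := by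
        rw [hk r hr]
        have := hy1 r hr
        exact mul_pos ((h0 r hr).lt_of_ne' hVr) (by linarith)
      have h2 : ∀ᶠ x in 𝓝 r, 0 < h 1 x := (hc 1).continuousAt.eventually (lt_mem_nhds hr0)
      have h3 : r ∈ closure (Ioo (0 : ℝ) 1) := by rwa [closure_Ioo zero_ne_one]
      obtain ⟨c, hc1, hc2⟩ := mem_closure_iff_nhds.1 h3 _ h2
      exact ⟨c, hc2, hc1⟩
    obtain ⟨c, hcI, hcp⟩ := hpos
    refine intervalIntegral.integral_pos zero_lt_one hcont hnn
      ⟨c, Ioo_subset_Icc_self hcI, ?_⟩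
    rw [one_mul]
    exact mul_pos (pow_pos hcI.1 _) hcp

/-! ### The truncated power and the shooting problem -/

/-- The power `x ↦ x₊ ^ p` truncated at the level `2`. -/
noncomputable def truncPow (p x : ℝ) : ℝ := min (max x 0) 2 ^ p

theorem truncPow_nonneg (p x : ℝ) : 0 ≤ truncPow p x :=
  Real.rpow_nonneg (le_min (le_max_right _ _) zero_le_two) _

theorem truncPow_le {p x y : ℝ} (hp : 0 ≤ p) (hxy : x ≤ y) (hy : 0 ≤ y) : truncPow p x ≤ y ^ p :=
  Real.rpow_le_rpow (le_min (le_max_right _ _) zero_le_two)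
    ((min_le_left _ _).trans (max_le hxy hy)) hp

theorem truncPow_eq {p x : ℝ} (h0 : 0 ≤ x) (h2 : x ≤ 2) : truncPow p x = x ^ p := by
  rw [truncPow, max_eq_left h0, min_eq_left h2]

theorem continuous_truncPow {p : ℝ} (hp : 0 ≤ p) : Continuous (truncPow p) := by
  unfold truncPow
  exact Continuous.rpow_const (by fun_prop) fun _ => Or.inr hp

/-- Truncation makes the power globally Lipschitz, as the initial value problem requires. It is
invisible on positive shots with 0 ≤ α ≤ 2, since these satisfy u ≤ αφ ≤ 2. -/
theorem exists_lipschitz_truncPow {p : ℝ} (hp : 1 ≤ p) :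
    ∃ L : ℝ, 0 ≤ L ∧ ∀ x y, |truncPow p x - truncPow p y| ≤ L * |x - y| := by
  refine ⟨p * 2 ^ (p - 1), by positivity, fun x y => ?_⟩
  have hmem : ∀ x : ℝ, min (max x 0) 2 ∈ Icc (0 : ℝ) 2 := fun x =>
    ⟨le_min (le_max_right _ _) zero_le_two, min_le_right _ _⟩
  have h1 := Convex.norm_image_sub_le_of_norm_hasDerivWithin_le (𝕜 := ℝ) (f := fun x : ℝ => x ^ p)
    (f' := fun x => p * x ^ (p - 1)) (s := Icc 0 2) (C := p * 2 ^ (p - 1))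
    (fun x _ => (Real.hasDerivAt_rpow_const (Or.inr hp)).hasDerivWithinAt)
    (fun x hx => by
      rw [Real.norm_of_nonneg (mul_nonneg (by linarith) (Real.rpow_nonneg hx.1 _))]
      have : x ^ (p - 1) ≤ 2 ^ (p - 1) := Real.rpow_le_rpow hx.1 hx.2 (by linarith)
      gcongr)
    (convex_Icc 0 2) (hmem y) (hmem x)
  refine h1.trans ?_
  rw [Real.norm_eq_abs]
  have h2 := abs_min_sub_min_le_max (max x 0) 2 (max y 0) 2
  have h3 := abs_max_sub_max_le_abs x y 0
  refine mul_le_mul_of_nonneg_left (h2.trans (max_le h3 ?_)) (by positivity)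
  simp

/-- `u` solves `u'' + (d / r) u' = V u - u₊ ^ p` (with the power truncated) on `[0,1]`, with
`u(0) = α φ(0)` and `u'(0) = 0`; `h` is a continuous extension of the right-hand side. -/
structure IsShot (d : ℕ) (V φ : ℝ → ℝ) (p α : ℝ) (u h : ℝ → ℝ) : Prop where
  cont : Continuous h
  eq : ∀ r, u r = α * φ 0 + radPot d h r
  source : ∀ r ∈ Icc (0 : ℝ) 1, h r = V r * u r - truncPow p (u r)

/-- The Wronskian flux `r ^ d (u φ' - u' φ)`. -/
noncomputable def flux (d : ℕ) (φ k u h : ℝ → ℝ) (r : ℝ) : ℝ :=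
  u r * (r ^ (d + 1) * radAvg d k r) - φ r * (r ^ (d + 1) * radAvg d h r)

namespace IsShot

variable {d : ℕ} {V φ k u h : ℝ → ℝ} {p α : ℝ}

theorem hasDerivAt (S : IsShot d V φ p α u h) (r : ℝ) : HasDerivAt u (r * radAvg d h r) r := by
  have := (hasDerivAt_radPot (d := d) S.cont r).const_add (α * φ 0)
  exact this.congr_of_eventuallyEq (Eventually.of_forall S.eq)

theorem continuous (S : IsShot d V φ p α u h) : Continuous u :=
  continuous_iff_continuousAt.2 fun r => (S.hasDerivAt r).continuousAt

theorem zero (S : IsShot d V φ p α u h) : u 0 = α * φ 0 := by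
  rw [S.eq, radPot_zero, add_zero]

/-- The terms with V and the products of first derivatives cancel, leaving only the nonlinear
contribution. -/
theorem hasDerivAt_flux (P : IsProfile d V φ k) (S : IsShot d V φ p α u h) {r : ℝ}
    (hr : r ∈ Icc (0 : ℝ) 1) :
    HasDerivAt (flux d φ k u h) (r ^ d * (φ r * truncPow p (u r))) r := by
  have h1 := ((S.hasDerivAt r).mul (hasDerivAt_pow_mul_radAvg (d := d) P.cont r)).sub
    ((P.hasDerivAt r).mul (hasDerivAt_pow_mul_radAvg (d := d) S.cont r))
  refine h1.congr_deriv ?_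
  rw [P.source r hr, S.source r hr]
  ring

theorem flux_zero : flux d φ k u h 0 = 0 := by simp [flux]

theorem flux_monotoneOn (P : IsProfile d V φ k) (S : IsShot d V φ p α u h) :
    MonotoneOn (flux d φ k u h) (Icc 0 1) := by
  refine monotoneOn_of_deriv_nonneg (convex_Icc 0 1)
    (fun x hx => (S.hasDerivAt_flux P hx).continuousAt.continuousWithinAt)
    (fun x hx => (S.hasDerivAt_flux P
      (interior_subset hx)).differentiableAt.differentiableWithinAt) fun x hx => ?_
  have hx' : x ∈ Icc (0 : ℝ) 1 := interior_subset hx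
  rw [(S.hasDerivAt_flux P hx').deriv]
  exact mul_nonneg (pow_nonneg hx'.1 _) (mul_nonneg (P.pos x hx').le (truncPow_nonneg _ _))

theorem flux_nonneg (P : IsProfile d V φ k) (S : IsShot d V φ p α u h) {r : ℝ}
    (hr : r ∈ Icc (0 : ℝ) 1) : 0 ≤ flux d φ k u h r := by
  have := S.flux_monotoneOn P ⟨le_rfl, zero_le_one⟩ hr hr.1
  rwa [flux_zero] at this

theorem flux_le (P : IsProfile d V φ k) (S : IsShot d V φ p α u h) {R M : ℝ}
    (hR : R ∈ Icc (0 : ℝ) 1) (hM : ∀ s ∈ Icc 0 R, truncPow p (u s) ≤ M) :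
    flux d φ k u h R ≤ M * φ R * R ^ (d + 1) := by
  have hsub : ∀ {x}, x ∈ Icc 0 R → x ∈ Icc (0 : ℝ) 1 := fun hx => ⟨hx.1, hx.2.trans hR.2⟩
  have hd : ∀ x ∈ Icc 0 R, HasDerivAt (fun x => M * φ R * x ^ (d + 1) - flux d φ k u h x)
      (M * φ R * ((d + 1 : ℕ) * x ^ d) - x ^ d * (φ x * truncPow p (u x))) x := fun x hx =>
    ((hasDerivAt_pow (d + 1) x).const_mul (M * φ R)).sub (S.hasDerivAt_flux P (hsub hx))
  have hmono : MonotoneOn (fun x => M * φ R * x ^ (d + 1) - flux d φ k u h x) (Icc 0 R) := by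
    refine monotoneOn_of_deriv_nonneg (convex_Icc 0 R)
      (fun x hx => (hd x hx).continuousAt.continuousWithinAt)
      (fun x hx => (hd x (interior_subset hx)).differentiableAt.differentiableWithinAt)
      fun x hx => ?_
    have hx' : x ∈ Icc 0 R := interior_subset hx
    rw [(hd x hx').deriv]
    have h1 : φ x * truncPow p (u x) ≤ M * φ R := by
      rw [mul_comm M]
      exact mul_le_mul (P.monotoneOn (hsub hx') hR hx'.2) (hM x hx') (truncPow_nonneg _ _)
        (P.pos R hR).le
    have h2 : 0 ≤ φ x * truncPow p (u x) :=
      mul_nonneg (P.pos x (hsub hx')).le (truncPow_nonneg _ _)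
    have h3 : 0 ≤ x ^ d := pow_nonneg hx'.1 d
    have h4 : (1 : ℝ) ≤ (d + 1 : ℕ) := by simp
    have h5 : M * φ R ≤ M * φ R * (d + 1 : ℕ) := le_mul_of_one_le_right (h2.trans h1) h4
    have h6 := mul_le_mul_of_nonneg_left (h1.trans h5) h3
    linarith
  have h0 := hmono ⟨le_rfl, hR.1⟩ ⟨hR.1, le_rfl⟩ hR.1
  simp only [flux_zero] at h0
  simp at h0
  exact h0

/-- Quotient rule: the numerator u'φ - uφ' is minus the flux divided by r^d. Monotonicity of u/φ and
all comparisons with αφ come from here. -/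
theorem hasDerivAt_ratio (P : IsProfile d V φ k) (S : IsShot d V φ p α u h) {r : ℝ}
    (hr : r ∈ Ioc (0 : ℝ) 1) :
    HasDerivAt (fun r => u r / φ r) (-(flux d φ k u h r / (r ^ d * φ r ^ 2))) r := by
  have hφ := (P.pos r ⟨hr.1.le, hr.2⟩).ne'
  have hr0 := hr.1.ne'
  refine ((S.hasDerivAt r).div (P.hasDerivAt r) hφ).congr_deriv ?_
  unfold flux
  field_simp
  ring

theorem ratio_zero (P : IsProfile d V φ k) (S : IsShot d V φ p α u h) : u 0 / φ 0 = α := by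
  rw [S.zero, mul_div_cancel_right₀ _ P.zero_pos.ne']

theorem continuousOn_ratio (P : IsProfile d V φ k) (S : IsShot d V φ p α u h) :
    ContinuousOn (fun r => u r / φ r) (Icc 0 1) :=
  S.continuous.continuousOn.div P.continuous.continuousOn fun r hr => (P.pos r hr).ne'

theorem ratio_antitoneOn (P : IsProfile d V φ k) (S : IsShot d V φ p α u h) :
    AntitoneOn (fun r => u r / φ r) (Icc 0 1) := by
  refine antitoneOn_of_deriv_nonpos (convex_Icc 0 1) (S.continuousOn_ratio P) ?_ ?_
  · intro x hx
    rw [interior_Icc] at hx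
    exact (S.hasDerivAt_ratio P ⟨hx.1, hx.2.le⟩).differentiableAt.differentiableWithinAt
  · intro x hx
    rw [interior_Icc] at hx
    rw [(S.hasDerivAt_ratio P ⟨hx.1, hx.2.le⟩).deriv, neg_nonpos]
    have := S.flux_nonneg P ⟨hx.1.le, hx.2.le⟩
    have := hx.1
    positivity

theorem ratio_le (P : IsProfile d V φ k) (S : IsShot d V φ p α u h) {r : ℝ}
    (hr : r ∈ Icc (0 : ℝ) 1) : u r / φ r ≤ α := by
  have := S.ratio_antitoneOn P ⟨le_rfl, zero_le_one⟩ hr hr.1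
  simpa only [S.ratio_zero P] using this

theorem le_mul (P : IsProfile d V φ k) (S : IsShot d V φ p α u h) {r : ℝ}
    (hr : r ∈ Icc (0 : ℝ) 1) : u r ≤ α * φ r :=
  (div_le_iff₀ (P.pos r hr)).1 (S.ratio_le P hr)

theorem le_of_nonneg (P : IsProfile d V φ k) (S : IsShot d V φ p α u h) (hα : 0 ≤ α) {r : ℝ}
    (hr : r ∈ Icc (0 : ℝ) 1) : u r ≤ α :=
  (S.le_mul P hr).trans (mul_le_of_le_one_right hα (P.le_one hr))

/-- By `flux_le` the derivative of u/φ is at least -Mx/φ(x) ≥ -M/φ(0), and the ratio starts at α. -/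
theorem le_ratio (P : IsProfile d V φ k) (S : IsShot d V φ p α u h) {R M : ℝ}
    (hR : R ∈ Icc (0 : ℝ) 1) (hM : ∀ s ∈ Icc 0 R, truncPow p (u s) ≤ M) :
    α - M / φ 0 ≤ u R / φ R := by
  have hM0 : 0 ≤ M := (truncPow_nonneg _ _).trans (hM 0 ⟨le_rfl, hR.1⟩)
  have h1 := Convex.mul_sub_le_image_sub_of_le_deriv (convex_Icc 0 R)
    (f := fun r => u r / φ r) ((S.continuousOn_ratio P).mono (Icc_subset_Icc_right hR.2))
    (by
      intro x hx
      rw [interior_Icc] at hx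
      exact (S.hasDerivAt_ratio P
        ⟨hx.1, hx.2.le.trans hR.2⟩).differentiableAt.differentiableWithinAt)
    (C := -(M / φ 0))
    (by
      intro x hx
      rw [interior_Icc] at hx
      have hx1 : x ∈ Icc (0 : ℝ) 1 := ⟨hx.1.le, hx.2.le.trans hR.2⟩
      rw [(S.hasDerivAt_ratio P ⟨hx.1, hx1.2⟩).deriv, neg_le_neg_iff]
      have h2 := S.flux_le P hx1 fun s hs => hM s ⟨hs.1, hs.2.trans hx.2.le⟩
      have hφ := P.pos x hx1
      have hx0 := hx.1
      have h3 := P.zero_le hx1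
      have h0 := P.zero_pos
      calc flux d φ k u h x / (x ^ d * φ x ^ 2)
          ≤ M * φ x * x ^ (d + 1) / (x ^ d * φ x ^ 2) := by gcongr
        _ = M * x / φ x := by
          rw [pow_succ]
          field_simp
        _ ≤ M * 1 / φ 0 := by
          gcongr
          exact hx1.2
        _ = M / φ 0 := by rw [mul_one])
    0 ⟨le_rfl, hR.1⟩ R ⟨hR.1, le_rfl⟩ hR.1
  simp only [S.ratio_zero P] at h1
  have h2 : M / φ 0 * R ≤ M / φ 0 :=
    mul_le_of_le_one_right (div_nonneg hM0 P.zero_pos.le) hR.2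
  linarith

/-- The definition of the flux solved for u': the slope is that of a multiple of φ minus a nonlinear
correction. -/
theorem deriv_eq (P : IsProfile d V φ k) {r : ℝ} (hr : r ∈ Ioc (0 : ℝ) 1) :
    r * radAvg d h r
      = u r / φ r * (r * radAvg d k r) - flux d φ k u h r / (r ^ d * φ r) := by
  have hφ := (P.pos r ⟨hr.1.le, hr.2⟩).ne'
  have hr0 := hr.1.ne'
  unfold flux
  field_simp
  ring

theorem deriv_le (P : IsProfile d V φ k) (S : IsShot d V φ p α u h) {r : ℝ}
    (hr : r ∈ Ioc (0 : ℝ) 1) :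
    r * radAvg d h r ≤ u r / φ r * (r * radAvg d k r) := by
  rw [deriv_eq (u := u) (φ := φ) P hr]
  have h1 := S.flux_nonneg P ⟨hr.1.le, hr.2⟩
  have h2 := P.pos r ⟨hr.1.le, hr.2⟩
  have h3 := hr.1
  have : 0 ≤ flux d φ k u h r / (r ^ d * φ r) := by positivity
  linarith

theorem flux_div_le (P : IsProfile d V φ k) (S : IsShot d V φ p α u h) {r M : ℝ}
    (hr : r ∈ Ioc (0 : ℝ) 1) (hM : ∀ s ∈ Icc 0 r, truncPow p (u s) ≤ M) :
    flux d φ k u h r / (r ^ d * φ r) ≤ M := by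
  have hr' : r ∈ Icc (0 : ℝ) 1 := ⟨hr.1.le, hr.2⟩
  have hM0 : 0 ≤ M := (truncPow_nonneg _ _).trans (hM 0 ⟨le_rfl, hr.1.le⟩)
  have h1 := S.flux_le P hr' hM
  have h2 := P.pos r hr'
  have h3 := hr.1
  calc flux d φ k u h r / (r ^ d * φ r) ≤ M * φ r * r ^ (d + 1) / (r ^ d * φ r) := by gcongr
    _ = M * r := by
      rw [pow_succ]
      field_simp
    _ ≤ M := mul_le_of_le_one_right hM0 hr.2

end IsShot

/-! ### Estimates in the boundary layer -/

/-- `[r₁, 1]` is a boundary layer on which `φ` has slope at least half its slope at `1`, and `a`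
an upper shooting level for which `a φ` stays below `1` up to `r₁`. -/
structure ShootingWindow (d : ℕ) (φ k : ℝ → ℝ) (r₁ a : ℝ) : Prop where
  half_le : 1 / 2 ≤ r₁
  lt_one : r₁ < 1
  slope : ∀ r ∈ Icc r₁ 1, radAvg d k 1 / 2 ≤ r * radAvg d k r
  one_lt : 1 < a
  le_two : a ≤ 2
  mul_lt : a * φ r₁ < 1

theorem IsProfile.exists_shootingWindow {d : ℕ} {V φ k : ℝ → ℝ} (P : IsProfile d V φ k) :
    ∃ r₁ a, ShootingWindow d φ k r₁ a := by
  have hm := P.slope_pos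
  have hc : Continuous fun r => r * radAvg d k r := continuous_id.mul (continuous_radAvg P.cont)
  have h1 : ∀ᶠ r in 𝓝 (1 : ℝ), radAvg d k 1 / 2 < r * radAvg d k r :=
    hc.continuousAt.eventually (lt_mem_nhds (by simp only [one_mul]; linarith))
  obtain ⟨ε, hε, hball⟩ := Metric.eventually_nhds_iff.1 h1
  set r₁ : ℝ := max (1 / 2) (1 - ε / 2) with hr₁
  have hlt : r₁ < 1 := max_lt (by norm_num) (by linarith)
  have hhalf : 1 / 2 ≤ r₁ := le_max_left _ _
  have hslope : ∀ r ∈ Icc r₁ 1, radAvg d k 1 / 2 ≤ r * radAvg d k r := by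
    intro r hr
    refine (hball ?_).le
    have : 1 - ε / 2 ≤ r := (le_max_right _ _).trans hr.1
    rw [Real.dist_eq, abs_lt]
    constructor <;> linarith [hr.2]
  have hφ : φ r₁ < 1 := by
    have := Convex.mul_sub_le_image_sub_of_le_deriv (convex_Icc r₁ 1) (f := φ)
      P.continuous.continuousOn
      (fun x _ => (P.hasDerivAt x).differentiableAt.differentiableWithinAt)
      (C := radAvg d k 1 / 2)
      (fun x hx => by
        rw [(P.hasDerivAt x).deriv]
        exact hslope x (interior_subset hx))
      r₁ ⟨le_rfl, hlt.le⟩ 1 ⟨hlt.le, le_rfl⟩ hlt.le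
    rw [P.one] at this
    nlinarith
  have hφ0 := P.pos r₁ ⟨by linarith, hlt.le⟩
  -- With δ = 1 - φ(r₁) > 0 one has (1 + δ/2)(1 - δ) < 1.
  refine ⟨r₁, 1 + (1 - φ r₁) / 2, hhalf, hlt, hslope, by linarith, by linarith, by nlinarith⟩

namespace IsShot

variable {d : ℕ} {V φ k u h : ℝ → ℝ} {p α r₁ a : ℝ}

theorem quarter_le_ratio (P : IsProfile d V φ k) (S : IsShot d V φ p α u h)
    (hα : 1 / 2 ≤ α) {R M : ℝ} (hR : R ∈ Icc (0 : ℝ) 1)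
    (hM : ∀ s ∈ Icc 0 R, truncPow p (u s) ≤ M) (hM1 : M ≤ φ 0 / 4) : 1 / 4 ≤ u R / φ R := by
  have h1 := S.le_ratio P hR hM
  have h2 : M / φ 0 ≤ 1 / 4 := by
    rw [div_le_iff₀ P.zero_pos]
    linarith
  linarith

/-- In `deriv_eq` the ratio is at least 1/4, the slope of φ at least m/2 with m = φ'(1), and the
correction at most m/16: m/8 - m/16 = m/16. -/
theorem le_deriv (P : IsProfile d V φ k) (W : ShootingWindow d φ k r₁ a)
    (S : IsShot d V φ p α u h) (hα : 1 / 2 ≤ α) {R M : ℝ} (hR : R ∈ Icc r₁ 1)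
    (hM : ∀ s ∈ Icc 0 R, truncPow p (u s) ≤ M) (hM1 : M ≤ φ 0 / 4)
    (hM2 : M ≤ radAvg d k 1 / 16) : radAvg d k 1 / 16 ≤ R * radAvg d h R := by
  have hR0 : R ∈ Ioc (0 : ℝ) 1 := ⟨by linarith [W.half_le, hR.1], hR.2⟩
  have h1 := S.quarter_le_ratio P hα ⟨hR0.1.le, hR.2⟩ hM hM1
  have h2 := S.flux_div_le P hR0 hM
  have h3 := W.slope R hR
  rw [deriv_eq (u := u) (φ := φ) P hR0]
  have hm := P.slope_pos
  nlinarith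

theorem truncPow_le_of_mem (P : IsProfile d V φ k) (W : ShootingWindow d φ k r₁ a)
    (S : IsShot d V φ p α u h) (hp : 0 ≤ p) (hα : 0 ≤ α) (hαa : α ≤ a) {s : ℝ}
    (hs : s ∈ Icc 0 r₁) :
    truncPow p (u s) ≤ (a * φ r₁) ^ p := by
  have hr₁ : r₁ ∈ Icc (0 : ℝ) 1 := ⟨by linarith [W.half_le], W.lt_one.le⟩
  have hs' : s ∈ Icc (0 : ℝ) 1 := ⟨hs.1, hs.2.trans hr₁.2⟩
  have h1 := P.monotoneOn hs' hr₁ hs.2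
  have h0 := P.pos s hs'
  have ha : 0 ≤ a := by linarith [W.one_lt]
  refine truncPow_le hp ((S.le_mul P hs').trans ?_) (mul_nonneg ha (h0.le.trans h1))
  gcongr

/-- For large `p` every shot follows the linear solution up to `r₁`. -/
theorem eventually_start (P : IsProfile d V φ k) (W : ShootingWindow d φ k r₁ a) :
    ∀ᶠ p : ℝ in atTop, ∀ α ∈ Icc (1 / 2) a, ∀ u h, IsShot d V φ p α u h →
      0 < u r₁ ∧ radAvg d k 1 / 16 ≤ r₁ * radAvg d h r₁ := by
  have hr₁ : r₁ ∈ Icc (0 : ℝ) 1 := ⟨by linarith [W.half_le], W.lt_one.le⟩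
  have hφ := P.pos r₁ hr₁
  have ha : 0 < a := by linarith [W.one_lt]
  have hθ : 0 < a * φ r₁ := mul_pos ha hφ
  have ht := tendsto_rpow_atTop_of_base_lt_one (a * φ r₁) (by linarith) W.mul_lt
  have hM : 0 < min (φ 0 / 4) (radAvg d k 1 / 16) :=
    lt_min (by linarith [P.zero_pos]) (by linarith [P.slope_pos])
  filter_upwards [ht.eventually (gt_mem_nhds hM), eventually_ge_atTop 0] with p h1 hp α hα u h S
  have hb : ∀ s ∈ Icc 0 r₁, truncPow p (u s) ≤ (a * φ r₁) ^ p := fun s hs =>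
    S.truncPow_le_of_mem P W hp (by linarith [hα.1]) hα.2 hs
  have hM1 := h1.le.trans (min_le_left _ _)
  refine ⟨?_, S.le_deriv P W hα.1 ⟨le_rfl, W.lt_one.le⟩ hb hM1 (h1.le.trans (min_le_right _ _))⟩
  have := (le_div_iff₀ hφ).1 (S.quarter_le_ratio P hα.1 hr₁ hb hM1)
  linarith

theorem monotoneOn_of_slope_nonneg (S : IsShot d V φ p α u h) {R : ℝ}
    (hmono : ∀ r ∈ Icc r₁ R, 0 ≤ r * radAvg d h r) : MonotoneOn u (Icc r₁ R) :=
  monotoneOn_of_deriv_nonneg (convex_Icc _ _) S.continuous.continuousOn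
    (fun x _ => (S.hasDerivAt x).differentiableAt.differentiableWithinAt) fun x hx => by
      rw [(S.hasDerivAt x).deriv]
      exact hmono x (interior_subset hx)

/-- While a shot increases, either its slope is bounded below or the nonlinear term is large. -/
theorem slope_or_large (P : IsProfile d V φ k) (W : ShootingWindow d φ k r₁ a)
    (S : IsShot d V φ p α u h) (hp : 1 ≤ p) (hα : α ∈ Icc (1 / 2) a) (h0 : 0 < u r₁) {K R : ℝ}
    (hK : 0 < K) (hKs : K ≤ r₁ ^ d * (r₁ * radAvg d h r₁)) (hR : R ∈ Icc r₁ 1)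
    (hmono : ∀ r ∈ Icc r₁ R, 0 ≤ r * radAvg d h r) :
    K / 2 ≤ R * radAvg d h R ∨ K ^ 2 * p / 8 ≤ truncPow p (u R) := by
  have hr₁ : 0 < r₁ := by linarith [W.half_le]
  have hum := S.monotoneOn_of_slope_nonneg hmono
  have hupos : ∀ r ∈ Icc r₁ R, 0 < u r := fun r hr =>
    h0.trans_le (hum ⟨le_rfl, hR.1⟩ hr hr.1)
  have hu2 : ∀ r ∈ Icc r₁ R, u r ≤ 2 := fun r hr =>
    (S.le_of_nonneg P (by linarith [hα.1])
      ⟨hr₁.le.trans hr.1, hr.2.trans hR.2⟩).trans (hα.2.trans W.le_two)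
  -- The energy is weighted by r^{2d} so that the friction term (d/r)u' cannot make it decrease.
  set En : ℝ → ℝ := fun r => (r ^ (d + 1) * radAvg d h r) ^ 2 / 2
    + (r ^ d) ^ 2 * (u r ^ (p + 1) / (p + 1)) with hEn
  have hd : ∀ r ∈ Icc r₁ R, HasDerivAt En
      ((r ^ (d + 1) * radAvg d h r) * (r ^ d * h r)
        + (2 * r ^ d * (d * r ^ (d - 1)) * (u r ^ (p + 1) / (p + 1))
        + (r ^ d) ^ 2 * (u r ^ p * (r * radAvg d h r)))) r := by
    intro r hr
    have e1 := ((hasDerivAt_pow_mul_radAvg (d := d) S.cont r).pow 2).div_const 2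
    have e2 := (hasDerivAt_pow d r).pow 2
    have e3 := ((S.hasDerivAt r).rpow_const (p := p + 1) (Or.inr (by linarith))).div_const (p + 1)
    refine (e1.add (e2.mul e3)).congr_deriv ?_
    have : p + 1 ≠ 0 := by linarith
    simp only [add_sub_cancel_right, Nat.cast_ofNat, Nat.add_one_sub_one, pow_one]
    field_simp
    simp only [Pi.pow_apply]
    ring
  have hEmono : MonotoneOn En (Icc r₁ R) := by
    refine monotoneOn_of_deriv_nonneg (convex_Icc _ _)
      (fun x hx => (hd x hx).continuousAt.continuousWithinAt)
      (fun x hx => (hd x (interior_subset hx)).differentiableAt.differentiableWithinAt)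
      fun x hx => ?_
    have hx' : x ∈ Icc r₁ R := interior_subset hx
    have hx1 : x ∈ Icc (0 : ℝ) 1 := ⟨hr₁.le.trans hx'.1, hx'.2.trans hR.2⟩
    have hup := hupos x hx'
    rw [(hd x hx').deriv, S.source x hx1, truncPow_eq hup.le (hu2 x hx')]
    -- The terms u^p u' cancel; what remains is nonnegative as u' ≥ 0, V ≥ 0 and u > 0.
    have e : (x ^ (d + 1) * radAvg d h x) * (x ^ d * (V x * u x - u x ^ p))
        + (2 * x ^ d * (d * x ^ (d - 1)) * (u x ^ (p + 1) / (p + 1))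
        + (x ^ d) ^ 2 * (u x ^ p * (x * radAvg d h x)))
        = (x ^ d) ^ 2 * (x * radAvg d h x) * (V x * u x)
        + 2 * x ^ d * (d * x ^ (d - 1)) * (u x ^ (p + 1) / (p + 1)) := by ring
    rw [e]
    have e1 := hmono x hx'
    have e2 := P.nonneg x hx1
    have e3 := hx1.1
    have e4 : 0 < p + 1 := by linarith
    positivity
  have hEE := hEmono ⟨le_rfl, hR.1⟩ ⟨hR.1, le_rfl⟩ hR.1
  have hR0 : 0 < R := hr₁.trans_le hR.1
  have huR := hupos R ⟨hR.1, le_rfl⟩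
  have hlow : K ^ 2 / 2 ≤ En r₁ := by
    have e1 : K ^ 2 ≤ (r₁ ^ (d + 1) * radAvg d h r₁) ^ 2 := by
      rw [pow_succ r₁ d, mul_assoc]
      gcongr
    have e2 : 0 ≤ (r₁ ^ d) ^ 2 * (u r₁ ^ (p + 1) / (p + 1)) := by positivity
    simp only [hEn]
    linarith
  have hup : En R ≤ (R * radAvg d h R) ^ 2 / 2 + u R ^ (p + 1) / (p + 1) := by
    have e0 : (R ^ d) ^ 2 ≤ 1 := by
      rw [← pow_mul]
      exact pow_le_one₀ hR0.le hR.2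
    have e1 : (R ^ (d + 1) * radAvg d h R) ^ 2 ≤ (R * radAvg d h R) ^ 2 := by
      rw [pow_succ R d, mul_assoc, mul_pow]
      exact mul_le_of_le_one_left (sq_nonneg _) e0
    have e2 : (R ^ d) ^ 2 * (u R ^ (p + 1) / (p + 1)) ≤ u R ^ (p + 1) / (p + 1) :=
      mul_le_of_le_one_left (by positivity) e0
    simp only [hEn]
    linarith
  rw [or_iff_not_imp_left, not_le]
  intro hs
  have hs0 := hmono R ⟨hR.1, le_rfl⟩
  have hs2 : (R * radAvg d h R) ^ 2 ≤ (K / 2) ^ 2 := by gcongr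
  -- If u' < K/2, kinetic energy accounts for at most K²/8 of K²/2. Below, u ≤ 2 converts
  -- u^{p+1}/(p+1) into u^p.
  have h3 : K ^ 2 / 4 ≤ u R ^ (p + 1) / (p + 1) := by nlinarith
  rw [le_div_iff₀ (by linarith), Real.rpow_add_one huR.ne'] at h3
  rw [truncPow_eq huR.le (hu2 R ⟨hR.1, le_rfl⟩)]
  have h4 : u R ^ p * u R ≤ u R ^ p * 2 := by
    have := hu2 R ⟨hR.1, le_rfl⟩
    gcongr
  nlinarith [sq_nonneg K]

theorem flux_one_le (P : IsProfile d V φ k) (S : IsShot d V φ p α u h) (hα0 : 0 ≤ α)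
    (hα : α ≤ 2) (h1 : 0 ≤ radAvg d h 1) : flux d φ k u h 1 ≤ 2 * radAvg d k 1 := by
  have e : flux d φ k u h 1 = u 1 * radAvg d k 1 - radAvg d h 1 := by simp [flux, P.one]
  have h2 := S.le_of_nonneg P hα0 (r := 1) ⟨zero_le_one, le_rfl⟩
  have := P.slope_pos
  rw [e]
  nlinarith

/-- The flux grows at rate at least r₁^d φ(0) M on [r,1], while it is nonnegative at r and at most
2φ'(1) at 1. -/
theorem mass_le (P : IsProfile d V φ k) (W : ShootingWindow d φ k r₁ a)
    (S : IsShot d V φ p α u h) (hα0 : 0 ≤ α) (hα : α ≤ 2) (h1 : 0 ≤ radAvg d h 1) {r M : ℝ}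
    (hr : r ∈ Icc r₁ 1) (hM0 : 0 ≤ M) (hM : ∀ s ∈ Icc r 1, M ≤ truncPow p (u s)) :
    r₁ ^ d * φ 0 * M * (1 - r) ≤ 2 * radAvg d k 1 := by
  have hr₁ : 0 < r₁ := by linarith [W.half_le]
  have hsub : ∀ {x}, x ∈ Icc r 1 → x ∈ Icc (0 : ℝ) 1 := fun hx =>
    ⟨hr₁.le.trans (hr.1.trans hx.1), hx.2⟩
  have h2 := Convex.mul_sub_le_image_sub_of_le_deriv (convex_Icc r 1) (f := flux d φ k u h)
    (fun x hx => (S.hasDerivAt_flux P (hsub hx)).continuousAt.continuousWithinAt)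
    (fun x hx => (S.hasDerivAt_flux P
      (hsub (interior_subset hx))).differentiableAt.differentiableWithinAt)
    (C := r₁ ^ d * φ 0 * M)
    (fun x hx => by
      have hx' := interior_subset hx
      rw [(S.hasDerivAt_flux P (hsub hx')).deriv, mul_assoc]
      have e1 := P.zero_le (hsub hx')
      have e2 := hM x hx'
      have e3 := P.zero_pos
      have e4 : r₁ ≤ x := hr.1.trans hx'.1
      have e5 : 0 < x := hr₁.trans_le e4
      have e6 : 0 < φ x := e3.trans_le e1
      gcongr)
    r ⟨le_rfl, hr.2⟩ 1 ⟨hr.2, le_rfl⟩ hr.2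
  have h3 := S.flux_one_le P hα0 hα h1
  have h4 := S.flux_nonneg P (hsub ⟨le_rfl, hr.2⟩)
  linarith

/-- The boundary value of an increasing shot does not exceed `1` in the limit. -/
theorem eventually_boundary_le (P : IsProfile d V φ k) (W : ShootingWindow d φ k r₁ a)
    {η : ℝ} (hη : 0 < η) :
    ∀ᶠ p : ℝ in atTop, ∀ α ∈ Icc (1 / 2) a, ∀ u h, IsShot d V φ p α u h →
      (∀ r ∈ Icc r₁ 1, 0 ≤ r * radAvg d h r) → u 1 ≤ 1 + η := by
  have hr₁ : 0 < r₁ := by linarith [W.half_le]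
  have hc : Continuous fun r => r * radAvg d k r := continuous_id.mul (continuous_radAvg P.cont)
  obtain ⟨B₀, hB₀⟩ := (isCompact_Icc (a := (0 : ℝ)) (b := 1)).exists_bound_of_continuousOn
    hc.continuousOn
  -- B bounds u' from above, because u' ≤ (u/φ)φ' ≤ 2φ'. Hence u(1) > 1 + η would keep u ≥ 1 + η/2
  -- on [ρ,1], whose length does not depend on p.
  set B : ℝ := 2 * |B₀| + 1 with hB
  have hB0 : 0 < B := by positivity
  set ρ : ℝ := max r₁ (1 - η / (2 * B)) with hρ
  have hρ1 : ρ < 1 := by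
    have : 0 < η / (2 * B) := by positivity
    exact max_lt W.lt_one (by linarith)
  have hρr : r₁ ≤ ρ := le_max_left _ _
  have hBρ : B * (1 - ρ) ≤ η / 2 := by
    have h1 : 1 - ρ ≤ η / (2 * B) := by
      have := le_max_right r₁ (1 - η / (2 * B))
      linarith
    calc B * (1 - ρ) ≤ B * (η / (2 * B)) := by gcongr
      _ = η / 2 := by field_simp
  set c : ℝ := r₁ ^ d * φ 0 * (1 - ρ) with hcdef
  have hc0 : 0 < c := by
    have := P.zero_pos
    have : 0 < 1 - ρ := by linarith
    positivity
  have hlarge : ∀ᶠ p : ℝ in atTop, 2 * radAvg d k 1 / (c * (η / 2)) < p := eventually_gt_atTop _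
  filter_upwards [hlarge, eventually_ge_atTop 1] with p hp hp1 α hα u h S hmono
  have hα0 : 0 ≤ α := by linarith [hα.1]
  have hα2 : α ≤ 2 := hα.2.trans W.le_two
  by_contra! hcon
  have hbig : ∀ s ∈ Icc ρ 1, 1 + η / 2 ≤ u s := by
    intro s hs
    have h1 := Convex.image_sub_le_mul_sub_of_deriv_le (convex_Icc s 1) (f := u)
      S.continuous.continuousOn
      (fun x _ => (S.hasDerivAt x).differentiableAt.differentiableWithinAt) (C := B)
      (fun x hx => by
        have hx' := interior_subset hx
        have hx1 : x ∈ Ioc (0 : ℝ) 1 := ⟨by linarith [hs.1, hx'.1], hx'.2⟩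
        have hxI : x ∈ Icc (0 : ℝ) 1 := ⟨hx1.1.le, hx1.2⟩
        rw [(S.hasDerivAt x).deriv]
        have e1 := S.deriv_le P hx1
        have e2 := (S.ratio_le P hxI).trans hα2
        have e3 : x * radAvg d k x ≤ |B₀| :=
          (le_abs_self _).trans ((hB₀ x hxI).trans (le_abs_self _))
        have e4 : 0 ≤ x * radAvg d k x := mul_nonneg hx1.1.le (P.radAvg_nonneg hxI)
        have e5 : u x / φ x * (x * radAvg d k x) ≤ 2 * (x * radAvg d k x) := by gcongr
        linarith)
      s ⟨le_rfl, hs.2⟩ 1 ⟨hs.2, le_rfl⟩ hs.2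
    have h2 : B * (1 - s) ≤ B * (1 - ρ) := by
      have := hs.1
      gcongr
    linarith
  have h1 := S.mass_le P W hα0 hα2 (by simpa using hmono 1 ⟨W.lt_one.le, le_rfl⟩)
    ⟨hρr, hρ1.le⟩ (M := (1 + η / 2) ^ p) (by positivity)
    (fun s hs => by
      have hs1 : s ∈ Icc (0 : ℝ) 1 := ⟨by linarith [hs.1], hs.2⟩
      have h2 := hbig s hs
      rw [truncPow_eq (by linarith) ((S.le_of_nonneg P hα0 hs1).trans hα2)]
      gcongr)
  -- Bernoulli's inequality: the mass grows at least linearly in p, against its fixed bound.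
  have h2 := one_add_mul_self_le_rpow_one_add (s := η / 2) (by linarith) hp1
  rw [div_lt_iff₀ (by positivity)] at hp
  have h3 : c * (1 + p * (η / 2)) ≤ c * (1 + η / 2) ^ p := by gcongr
  have h4 : r₁ ^ d * φ 0 * (1 + η / 2) ^ p * (1 - ρ) = c * (1 + η / 2) ^ p := by
    rw [hcdef]
    ring
  nlinarith

/-- The nonlinear term of an increasing shot concentrates at the boundary. -/
theorem eventually_truncPow_le (P : IsProfile d V φ k) (W : ShootingWindow d φ k r₁ a)
    {η : ℝ} (hη : 0 < η) :
    ∀ᶠ p : ℝ in atTop, ∀ α ∈ Icc (1 / 2) a, ∀ u h, IsShot d V φ p α u h →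
      (∀ r ∈ Icc r₁ 1, 0 ≤ r * radAvg d h r) →
      ∀ r ∈ Icc 0 (1 - η), truncPow p (u r) ≤ η := by
  have hr₁ : 0 < r₁ := by linarith [W.half_le]
  have hφ := P.pos r₁ ⟨hr₁.le, W.lt_one.le⟩
  have ha : 0 < a := by linarith [W.one_lt]
  have hθ : 0 < a * φ r₁ := mul_pos ha hφ
  have hm := P.slope_pos
  set K : ℝ := r₁ ^ d * (radAvg d k 1 / 16) with hKdef
  have hK : 0 < K := by positivity
  -- θ < 1 will bound u on [0, 1 - η]: by aφ(r₁) up to r₁, and beyond by 1 + Kη/8 - Kη/4, the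
  -- boundary bound less the rise over [1 - η, 1 - η/2] at slope K/2.
  set θ : ℝ := max (a * φ r₁) (1 - K * η / 8) with hθdef
  have hθ1 : θ < 1 := max_lt W.mul_lt (by
    have : 0 < K * η / 8 := by positivity
    linarith)
  have hθ0 : 0 < θ := hθ.trans_le (le_max_left _ _)
  have ht := tendsto_rpow_atTop_of_base_lt_one θ (by linarith) hθ1
  set c : ℝ := r₁ ^ d * φ 0 * (K ^ 2 / 8) * (η / 2) with hcdef
  have hc0 : 0 < c := by
    have := P.zero_pos
    positivity
  filter_upwards [ht.eventually (gt_mem_nhds hη), eventually_start P W,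
    eventually_boundary_le P W (η := K * η / 8) (by positivity),
    eventually_gt_atTop (2 * radAvg d k 1 / c), eventually_ge_atTop 1]
    with p hpow hstart hbd hlarge hp1 α hα u h S hmono
  have hα0 : 0 ≤ α := by linarith [hα.1]
  have hα2 : α ≤ 2 := hα.2.trans W.le_two
  obtain ⟨hu0, hs0⟩ := hstart α hα u h S
  have hu1 := hbd α hα u h S hmono
  have hum := S.monotoneOn_of_slope_nonneg hmono
  have hfast : ∀ r ∈ Icc r₁ (1 - η / 2), K / 2 ≤ r * radAvg d h r := by
    intro r hr
    have hr1 : r ∈ Icc r₁ 1 := ⟨hr.1, by linarith [hr.2]⟩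
    rcases S.slope_or_large P W hp1 hα hu0 hK
      (mul_le_mul_of_nonneg_left hs0 (by positivity)) hr1
      (fun s hs => hmono s ⟨hs.1, hs.2.trans hr1.2⟩) with h1 | h1
    · exact h1
    -- As u is nondecreasing, u^p would stay of order p from r to 1, over a length at least η/2,
    -- contradicting the mass bound.
    · exfalso
      have hpos : ∀ s ∈ Icc r₁ 1, 0 < u s := fun s hs =>
        hu0.trans_le (hum ⟨le_rfl, W.lt_one.le⟩ hs hs.1)
      have hle2 : ∀ s ∈ Icc r₁ 1, u s ≤ 2 := fun s hs =>
        (S.le_of_nonneg P hα0 ⟨hr₁.le.trans hs.1, hs.2⟩).trans hα2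
      have h2 := S.mass_le P W hα0 hα2 (by simpa using hmono 1 ⟨W.lt_one.le, le_rfl⟩) hr1
        (M := K ^ 2 * p / 8) (by positivity) (fun s hs => by
          have hs1 : s ∈ Icc r₁ 1 := ⟨hr.1.trans hs.1, hs.2⟩
          refine h1.trans ?_
          rw [truncPow_eq (hpos r hr1).le (hle2 r hr1), truncPow_eq (hpos s hs1).le (hle2 s hs1)]
          exact Real.rpow_le_rpow (hpos r hr1).le (hum hr1 hs1 hs.1) (by linarith))
      rw [div_lt_iff₀ hc0] at hlarge
      have h3 : r₁ ^ d * φ 0 * (K ^ 2 * p / 8) * (η / 2)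
          ≤ r₁ ^ d * φ 0 * (K ^ 2 * p / 8) * (1 - r) := by
        have := P.zero_pos
        gcongr
        linarith [hr.2]
      have h4 : r₁ ^ d * φ 0 * (K ^ 2 * p / 8) * (η / 2) = p * c := by
        rw [hcdef]
        ring
      linarith
  intro r hr
  refine (truncPow_le (by linarith) (y := θ) ?_ hθ0.le).trans hpow.le
  rcases le_total r r₁ with hle | hle
  · have hrI : r ∈ Icc (0 : ℝ) 1 := ⟨hr.1, by linarith [hr.2]⟩
    have h1 := P.monotoneOn hrI ⟨hr₁.le, W.lt_one.le⟩ hle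
    have h0 := P.pos r hrI
    refine (S.le_mul P hrI).trans (le_trans ?_ (le_max_left _ _))
    have := hα.2
    gcongr
  · refine le_trans ?_ (le_max_right _ _)
    have h1 := Convex.mul_sub_le_image_sub_of_le_deriv (convex_Icc r₁ (1 - η / 2)) (f := u)
      S.continuous.continuousOn
      (fun x _ => (S.hasDerivAt x).differentiableAt.differentiableWithinAt) (C := K / 2)
      (fun x hx => by
        rw [(S.hasDerivAt x).deriv]
        exact hfast x (interior_subset hx))
      r ⟨hle, by linarith [hr.2]⟩ (1 - η / 2) ⟨by linarith [hr.2], le_rfl⟩ (by linarith [hr.2])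
    have h2 := hum (a := 1 - η / 2) (b := 1) ⟨by linarith [hr.2], by linarith⟩
      ⟨W.lt_one.le, le_rfl⟩ (by linarith)
    have h3 : K / 2 * (η / 2) ≤ K / 2 * (1 - η / 2 - r) := by
      gcongr
      linarith [hr.2]
    linarith

end IsShot

/-! ### Choice of the shooting level -/

theorem IsProfile.exists_shots {d : ℕ} {V φ k : ℝ → ℝ} (P : IsProfile d V φ k)
    (hV : ContinuousOn V (Icc 0 1)) {p : ℝ} (hp : 1 ≤ p) :
    ∃ u h : ℝ → ℝ → ℝ, (∀ α, IsShot d V φ p α (u α) (h α)) ∧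
      ∃ C : NNReal, ∀ α β, ∀ r ∈ Icc (0 : ℝ) 1,
        |r * radAvg d (h α) r - r * radAvg d (h β) r| ≤ C * |α - β| := by
  obtain ⟨L, hL⟩ := isCompact_Icc.exists_bound_of_continuousOn hV
  obtain ⟨L', -, hL'⟩ := exists_lipschitz_truncPow hp
  have hVc := continuous_projIcc_comp hV
  obtain ⟨h, C, hc, heq, hlip⟩ := exists_radial_ivp d
    (fun s x => V (projIcc (0 : ℝ) 1 zero_le_one s) * x - truncPow p x)
    (((hVc.comp continuous_fst).mul continuous_snd).sub
      ((continuous_truncPow (by linarith)).comp continuous_snd)) (L + L') (by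
      intro s hs x y
      rw [projIcc_of_mem zero_le_one hs]
      have e : V s * x - truncPow p x - (V s * y - truncPow p y)
          = V s * (x - y) - (truncPow p x - truncPow p y) := by ring
      simp only [e]
      refine (abs_sub _ _).trans ?_
      rw [abs_mul, add_mul]
      exact add_le_add (mul_le_mul_of_nonneg_right (hL s hs) (abs_nonneg _)) (hL' x y))
  refine ⟨fun α r => α * φ 0 + radPot d (h (α * φ 0)) r, fun α => h (α * φ 0), fun α =>
    ⟨hc _, fun r => rfl, fun r hr => ?_⟩, Real.toNNReal (|C| * φ 0), fun α β r hr => ?_⟩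
  · have := heq (α * φ 0) r hr
    rwa [projIcc_of_mem zero_le_one hr] at this
  · rw [Real.coe_toNNReal _ (mul_nonneg (abs_nonneg _) P.zero_pos.le), ← mul_sub,
      radAvg_sub (hc _) (hc _), abs_mul, abs_of_nonneg hr.1]
    have h1 := abs_radAvg_le (d := d) (h := fun s => h (α * φ 0) s - h (β * φ 0) s)
      (M := |C| * φ 0 * |α - β|) hr.1 (fun s hs => by
        refine (hlip _ _ s ⟨hs.1, hs.2.trans hr.2⟩).trans ?_
        rw [← sub_mul, abs_mul, abs_of_pos P.zero_pos]
        have := P.zero_pos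
        calc C * (|α - β| * φ 0) ≤ |C| * (|α - β| * φ 0) := by
              gcongr
              exact le_abs_self C
          _ = _ := by ring)
    exact (mul_le_of_le_one_left (abs_nonneg _) hr.2).trans h1

namespace IsShot

variable {d : ℕ} {V φ k u h : ℝ → ℝ} {p α r₁ a : ℝ}

/-- The ratio u/φ loses at most η/φ(0) up to 1 - η, where u^p ≤ η. On the remaining length η its
derivative is bounded because the flux is at most 2φ'(1); and φ(1) = 1. -/
theorem sub_le_boundary (P : IsProfile d V φ k) (S : IsShot d V φ p α u h) (hα0 : 0 ≤ α)
    (hα : α ≤ 2) (h1 : 0 ≤ radAvg d h 1) {η : ℝ} (hη : 0 ≤ η) (hη2 : η ≤ 1 / 2)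
    (hb : ∀ r ∈ Icc 0 (1 - η), truncPow p (u r) ≤ η) :
    α - (1 / φ 0 + 2 * radAvg d k 1 / ((1 / 2) ^ d * φ 0 ^ 2)) * η ≤ u 1 := by
  have h0 := P.zero_pos
  have hm := P.slope_pos
  have hsub : Icc (1 - η) 1 ⊆ Icc (0 : ℝ) 1 := Icc_subset_Icc_left (by linarith)
  have e1 := S.le_ratio P (R := 1 - η) ⟨by linarith, by linarith⟩ hb
  have e2 := Convex.mul_sub_le_image_sub_of_le_deriv (convex_Icc (1 - η) 1)
    (f := fun r => u r / φ r) ((S.continuousOn_ratio P).mono hsub)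
    (fun x hx => (S.hasDerivAt_ratio P ⟨by linarith [(interior_subset hx).1],
      (interior_subset hx).2⟩).differentiableAt.differentiableWithinAt)
    (C := -(2 * radAvg d k 1 / ((1 / 2) ^ d * φ 0 ^ 2)))
    (fun x hx => by
      have hx' := interior_subset hx
      have hx2 : 1 / 2 ≤ x := by linarith [hx'.1]
      have hx0 : 0 < x := by linarith
      rw [(S.hasDerivAt_ratio P ⟨hx0, hx'.2⟩).deriv, neg_le_neg_iff]
      have e3 := S.flux_one_le P hα0 hα h1
      have e4 := S.flux_monotoneOn P (hsub hx') ⟨zero_le_one, le_rfl⟩ hx'.2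
      have e5 := P.zero_le (hsub hx')
      exact div_le_div₀ (by positivity) (e4.trans e3) (by positivity) (by gcongr))
    (1 - η) ⟨le_rfl, by linarith⟩ 1 ⟨by linarith, le_rfl⟩ (by linarith)
  simp only [P.one, div_one] at e2
  rw [add_mul, one_div_mul_eq_div]
  linarith

/-- For large `p`, the first critical point of an increasing shot is nondegenerate, so it does not
lie in the open boundary layer. -/
theorem eventually_zero_eq_one (P : IsProfile d V φ k) (W : ShootingWindow d φ k r₁ a) :
    ∀ᶠ p : ℝ in atTop, ∀ α ∈ Icc (1 / 2) a, ∀ u h, IsShot d V φ p α u h →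
      (∀ r ∈ Icc r₁ 1, 0 ≤ r * radAvg d h r) →
      ∀ r ∈ Icc r₁ 1, r * radAvg d h r = 0 → r = 1 := by
  have hr₁ : 0 < r₁ := by linarith [W.half_le]
  have hm := P.slope_pos
  set K : ℝ := r₁ ^ d * (radAvg d k 1 / 16) with hKdef
  have hK : 0 < K := by positivity
  obtain ⟨B, hB⟩ := (isCompact_Icc (a := (0 : ℝ)) (b := 1)).exists_bound_of_continuousOn
    P.cont.continuousOn
  filter_upwards [eventually_start P W, eventually_ge_atTop 1,
    eventually_gt_atTop (2 * B / (K ^ 2 / 8))] with p hstart hp1 hlarge α hα u h S hmono r hr hz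
  obtain ⟨hu0, hs0⟩ := hstart α hα u h S
  by_contra hne
  have hrlt : r < 1 := lt_of_le_of_ne hr.2 hne
  have hgt : r₁ < r := by
    refine lt_of_le_of_ne hr.1 fun he => ?_
    rw [← he] at hz
    linarith
  have hr0 : 0 < r := hr₁.trans hgt
  have hrI : r ∈ Icc (0 : ℝ) 1 := ⟨hr0.le, hr.2⟩
  -- An interior zero of u' ≥ 0 minimises r^d u', so (r^d u')' = r^d h vanishes, whence u^p = Vu
  -- there.
  have hmin : IsLocalMin (fun t => t ^ (d + 1) * radAvg d h t) r := by
    filter_upwards [Icc_mem_nhds hgt hrlt] with t ht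
    have e1 := hmono t ht
    have e2 : 0 ≤ t ^ d := pow_nonneg (hr₁.le.trans ht.1) _
    rw [pow_succ, mul_assoc, hz, mul_zero, pow_succ, mul_assoc]
    exact mul_nonneg e2 e1
  have hh0 := hmin.hasDerivAt_eq_zero (hasDerivAt_pow_mul_radAvg (d := d) S.cont r)
  have hh : h r = 0 := by
    rcases mul_eq_zero.1 hh0 with e | e
    · exact absurd e (pow_pos hr0 _).ne'
    · exact e
  have hφ := P.pos r hrI
  have heq : truncPow p (u r) = k r * (u r / φ r) := by
    have := S.source r hrI
    rw [P.source r hrI]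
    field_simp
    linarith
  have hle : truncPow p (u r) ≤ 2 * B := by
    have e1 := (S.ratio_le P hrI).trans (hα.2.trans W.le_two)
    have e2 := P.source_nonneg hrI
    have e3 := (le_abs_self _).trans (hB r hrI)
    rw [heq]
    calc k r * (u r / φ r) ≤ k r * 2 := by gcongr
      _ ≤ 2 * B := by linarith
  rw [div_lt_iff₀ (by positivity)] at hlarge
  rcases S.slope_or_large P W hp1 hα hu0 hK (mul_le_mul_of_nonneg_left hs0 (by positivity)) hr
    (fun s hs => hmono s ⟨hs.1, hs.2.trans hr.2⟩) with e | e
  · linarith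
  · linarith

end IsShot

/-- Existence and asymptotics of Neumann shots: they are close to `φ`. -/
theorem IsProfile.exists_neumann_shot {d : ℕ} {V φ k : ℝ → ℝ} (P : IsProfile d V φ k)
    (hV : ContinuousOn V (Icc 0 1)) :
    ∃ B : ℝ, ∀ ε > 0, ∀ᶠ p : ℝ in atTop, ∃ α u h, IsShot d V φ p α u h ∧ α ≤ 2 ∧
      radAvg d h 1 = 0 ∧ (∀ r ∈ Icc (0 : ℝ) 1, 0 < u r ∧ |u r - φ r| ≤ ε) ∧
      (∀ r ∈ Icc (0 : ℝ) 1, |r * radAvg d h r - r * radAvg d k r| ≤ B) ∧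
      ∀ r ∈ Icc 0 (1 - ε), |r * radAvg d h r - r * radAvg d k r| ≤ ε := by
  obtain ⟨r₁, a, W⟩ := P.exists_shootingWindow
  have hr₁ : 0 < r₁ := by linarith [W.half_le]
  have h0 := P.zero_pos
  have hm := P.slope_pos
  have hc : Continuous fun r => r * radAvg d k r := continuous_id.mul (continuous_radAvg P.cont)
  obtain ⟨B₀, hB₀⟩ := (isCompact_Icc (a := (0 : ℝ)) (b := 1)).exists_bound_of_continuousOn
    hc.continuousOn
  have hB00 : 0 ≤ B₀ := (norm_nonneg _).trans (hB₀ 0 ⟨le_rfl, zero_le_one⟩)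
  refine ⟨2 * B₀ + 1, fun ε hε => ?_⟩
  -- The half-width of the interval of shooting levels. The factor 2B₀ + 3 absorbs the errors 2ε₀ in
  -- u and 2ε₀B₀ + η in u'; η is later chosen with (C + 1)η ≤ ε₀/2.
  set ε₀ : ℝ := min (min (1 / 4) (a - 1)) (ε / (2 * B₀ + 3)) with hε₀
  have hε₀0 : 0 < ε₀ := lt_min (lt_min (by norm_num) (by linarith [W.one_lt])) (by positivity)
  have hε₀4 : ε₀ ≤ 1 / 4 := (min_le_left _ _).trans (min_le_left _ _)
  have hε₀a : ε₀ ≤ a - 1 := (min_le_left _ _).trans (min_le_right _ _)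
  have hε₀ε : ε₀ * (2 * B₀ + 3) ≤ ε := (le_div_iff₀ (by positivity)).1 (min_le_right _ _)
  set C : ℝ := 1 / φ 0 + 2 * radAvg d k 1 / ((1 / 2) ^ d * φ 0 ^ 2) with hC
  have hC0 : 0 < C := by positivity
  set η : ℝ := min (ε₀ / (2 * (C + 1))) (1 - r₁) with hη
  have hη0 : 0 < η := lt_min (by positivity) (by linarith [W.lt_one])
  have hηr : r₁ ≤ 1 - η := by linarith [min_le_right (ε₀ / (2 * (C + 1))) (1 - r₁)]
  have hηC : η * (2 * (C + 1)) ≤ ε₀ := (le_div_iff₀ (by positivity)).1 (min_le_left _ _)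
  have hηε : η ≤ ε₀ := by nlinarith
  have hη2 : η ≤ 1 / 2 := by linarith
  have hsmall := tendsto_rpow_atTop_of_base_lt_one (1 - ε₀) (by linarith) (by linarith)
  have hM : 0 < min (φ 0 / 4) (radAvg d k 1 / 16) := lt_min (by linarith) (by linarith)
  filter_upwards [eventually_ge_atTop 1, IsShot.eventually_truncPow_le P W hη0,
    IsShot.eventually_boundary_le P W hη0, IsShot.eventually_zero_eq_one P W,
    hsmall.eventually (gt_mem_nhds hM)] with p hp hconc hbd hzero hpow
  obtain ⟨u, h, hS, L, hL⟩ := P.exists_shots hV hp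
  have hclose : ∀ α ∈ Icc (1 / 2) a, (∀ r ∈ Icc r₁ 1, 0 ≤ r * radAvg d (h α) r) →
      α - C * η ≤ u α 1 := fun α hα hmono =>
    (hS α).sub_le_boundary P (by linarith [hα.1]) (hα.2.trans W.le_two)
      (by simpa using hmono 1 ⟨W.lt_one.le, le_rfl⟩) hη0.le hη2 (hconc α hα _ _ (hS α) hmono)
  -- The slope of the shot, extended constantly outside [0,1] to be jointly continuous on the plane;
  -- its minimum over [r₁,1] is then continuous in α.
  set F : ℝ → ℝ → ℝ := fun α r => (projIcc (0 : ℝ) 1 zero_le_one r : ℝ)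
    * radAvg d (h α) (projIcc (0 : ℝ) 1 zero_le_one r) with hF
  have hFeq : ∀ α, ∀ r ∈ Icc r₁ 1, F α r = r * radAvg d (h α) r := by
    intro α r hr
    have hr' : r ∈ Icc (0 : ℝ) 1 := ⟨hr₁.le.trans hr.1, hr.2⟩
    simp only [hF, projIcc_of_mem zero_le_one hr']
  have hFr : ∀ α, Continuous (F α) := fun α => by
    have e1 : Continuous fun r : ℝ => (projIcc (0 : ℝ) 1 zero_le_one r : ℝ) :=
      continuous_subtype_val.comp continuous_projIcc
    exact e1.mul ((continuous_radAvg (hS α).cont).comp e1)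
  have hFc : Continuous ↿F := by
    refine continuous_prod_of_continuous_lipschitzWith (fun x : ℝ × ℝ => F x.1 x.2) L
      (fun α => hFr α) fun r => LipschitzWith.of_dist_le_mul fun α β => ?_
    exact hL α β _ (projIcc (0 : ℝ) 1 zero_le_one r).2
  have hgc : Continuous fun α => sInf (F α '' Icc r₁ 1) := isCompact_Icc.continuous_sInf hFc
  have hne : (Icc r₁ 1).Nonempty := ⟨1, W.lt_one.le, le_rfl⟩
  have hatt : ∀ α, ∃ r ∈ Icc r₁ 1, sInf (F α '' Icc r₁ 1) = F α r := fun α =>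
    isCompact_Icc.exists_sInf_image_eq hne (hFr α).continuousOn
  have hinf : ∀ α, ∀ r ∈ Icc r₁ 1, sInf (F α '' Icc r₁ 1) ≤ F α r := fun α r hr =>
    csInf_le (isCompact_Icc.image (hFr α)).bddBelow (mem_image_of_mem _ hr)
  have hlow : 0 ≤ sInf (F (1 - ε₀) '' Icc r₁ 1) := by
    obtain ⟨r, hr, he⟩ := hatt (1 - ε₀)
    rw [he, hFeq _ r hr]
    have hb : ∀ s ∈ Icc 0 r, truncPow p (u (1 - ε₀) s) ≤ (1 - ε₀) ^ p := fun s hs =>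
      truncPow_le (by linarith) ((hS _).le_of_nonneg P (by linarith) ⟨hs.1, hs.2.trans hr.2⟩)
        (by linarith)
    have := (hS (1 - ε₀)).le_deriv P W (by linarith) hr hb (hpow.le.trans (min_le_left _ _))
      (hpow.le.trans (min_le_right _ _))
    linarith
  -- A positive minimum would give 1 + ε₀ - Cη ≤ u(1) ≤ 1 + η, impossible as (C + 1)η ≤ ε₀/2.
  have hhigh : sInf (F (1 + ε₀) '' Icc r₁ 1) ≤ 0 := by
    by_contra! hcon
    have hα : 1 + ε₀ ∈ Icc (1 / 2) a := ⟨by linarith, by linarith⟩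
    have hmono : ∀ r ∈ Icc r₁ 1, 0 ≤ r * radAvg d (h (1 + ε₀)) r := fun r hr =>
      hFeq _ r hr ▸ hcon.le.trans (hinf _ r hr)
    have e1 := hclose _ hα hmono
    have e2 := hbd _ hα _ _ (hS _) hmono
    nlinarith
  obtain ⟨α, hα, hα0⟩ := intermediate_value_Icc' (by linarith) hgc.continuousOn ⟨hhigh, hlow⟩
  simp only at hα0
  have hαI : α ∈ Icc (1 / 2) a := ⟨by linarith [hα.1], by linarith [hα.2]⟩
  have hα2 : α ≤ 2 := hαI.2.trans W.le_two
  have hmono : ∀ r ∈ Icc r₁ 1, 0 ≤ r * radAvg d (h α) r := fun r hr =>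
    hFeq _ r hr ▸ hα0 ▸ hinf _ r hr
  have S := hS α
  -- The zero minimum is attained, and `eventually_zero_eq_one` leaves only the endpoint.
  have hone : radAvg d (h α) 1 = 0 := by
    obtain ⟨r, hr, he⟩ := hatt α
    rw [hα0, hFeq _ r hr] at he
    have hr1 := hzero α hαI _ _ S hmono r hr he.symm
    rw [hr1, one_mul] at he
    exact he.symm
  have hratio : ∀ r ∈ Icc (0 : ℝ) 1, |u α r / φ r - 1| ≤ 2 * ε₀ := by
    intro r hr
    have e1 := S.ratio_le P hr
    have e2 := S.ratio_antitoneOn P hr ⟨zero_le_one, le_rfl⟩ hr.2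
    simp only [P.one, div_one] at e2
    have e3 := hclose α hαI hmono
    rw [abs_le]
    constructor <;> nlinarith [hα.1, hα.2]
  have hslope : ∀ r ∈ Icc (0 : ℝ) 1, 0 ≤ r * radAvg d k r ∧ r * radAvg d k r ≤ B₀ := fun r hr =>
    ⟨mul_nonneg hr.1 (P.radAvg_nonneg hr), (le_abs_self _).trans (hB₀ r hr)⟩
  have hin : ∀ r ∈ Icc 0 (1 - η),
      |r * radAvg d (h α) r - r * radAvg d k r| ≤ 2 * ε₀ * B₀ + η := by
    intro r hr
    rcases hr.1.eq_or_lt with he | hr0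
    · rw [← he]
      simp only [zero_mul, sub_self, abs_zero]
      positivity
    have hrI : r ∈ Icc (0 : ℝ) 1 := ⟨hr.1, by linarith [hr.2]⟩
    have hb := hconc α hαI _ _ S hmono
    have e1 := S.flux_div_le P ⟨hr0, hrI.2⟩ fun s hs => hb s ⟨hs.1, hs.2.trans hr.2⟩
    have e2 : 0 ≤ flux d φ k (u α) (h α) r / (r ^ d * φ r) := by
      have := S.flux_nonneg P hrI
      have := P.pos r hrI
      positivity
    have e3 := IsShot.deriv_eq (u := u α) (h := h α) P ⟨hr0, hrI.2⟩
    have e4 : |(u α r / φ r - 1) * (r * radAvg d k r)| ≤ 2 * ε₀ * B₀ := by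
      rw [abs_mul]
      exact mul_le_mul (hratio r hrI) (hB₀ r hrI) (abs_nonneg _) (by positivity)
    rw [abs_le] at e4 ⊢
    constructor <;> linarith [e4.1, e4.2]
  refine ⟨α, u α, h α, S, hα2, hone, fun r hr => ?_, fun r hr => ?_, fun r hr => ?_⟩
  · have hφ := P.pos r hr
    have e1 := abs_le.1 (hratio r hr)
    have e2 : u α r = u α r / φ r * φ r := by field_simp
    refine ⟨?_, ?_⟩
    · rw [e2]
      exact mul_pos (by linarith [e1.1]) hφ
    · have e3 : u α r - φ r = (u α r / φ r - 1) * φ r := by field_simp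
      rw [e3, abs_mul, abs_of_pos hφ]
      have e4 := P.le_one hr
      calc |u α r / φ r - 1| * φ r ≤ 2 * ε₀ * 1 :=
            mul_le_mul (hratio r hr) e4 hφ.le (by positivity)
        _ ≤ ε := by nlinarith
  · rcases le_total r (1 - η) with hle | hle
    · refine (hin r ⟨hr.1, hle⟩).trans ?_
      nlinarith
    -- Near the boundary convergence of u' fails, as u'(1) = 0 < φ'(1); only the bound 0 ≤ u' ≤ 2φ'
    -- is kept.
    · have hrI : r ∈ Icc r₁ 1 := ⟨hηr.trans hle, hr.2⟩
      have e1 := S.deriv_le P ⟨hr₁.trans_le hrI.1, hr.2⟩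
      have e2 := hmono r hrI
      have e3 := hslope r hr
      have e4 := (S.ratio_le P hr).trans hα2
      have e5 : u α r / φ r * (r * radAvg d k r) ≤ 2 * (r * radAvg d k r) :=
        mul_le_mul_of_nonneg_right e4 e3.1
      rw [abs_le]
      constructor <;> linarith [e3.1, e3.2]
  · refine (hin r ⟨hr.1, ?_⟩).trans ?_
    · have : ε₀ ≤ ε := by nlinarith
      linarith [hr.2]
    · nlinarith

/-! ### Construction of the Green function -/

theorem contDiffOn_two_of_hasDerivAt {y y₁ y₂ : ℝ → ℝ} {s : Set ℝ} (hs : IsOpen s)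
    (h₁ : ∀ r ∈ s, HasDerivAt y (y₁ r) r) (h₂ : ∀ r ∈ s, HasDerivAt y₁ (y₂ r) r)
    (hc : ContinuousOn y₂ s) : ContDiffOn ℝ 2 y s := by
  have e : (2 : WithTop ℕ∞) = 1 + 1 := by norm_num
  have e0 : (1 : WithTop ℕ∞) = 0 + 1 := by norm_num
  rw [e, contDiffOn_succ_iff_deriv_of_isOpen hs]
  refine ⟨fun r hr => (h₁ r hr).differentiableAt.differentiableWithinAt, by simp, ?_⟩
  have hd : ContDiffOn ℝ 1 y₁ s := by
    rw [e0, contDiffOn_succ_iff_deriv_of_isOpen hs]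
    refine ⟨fun r hr => (h₂ r hr).differentiableAt.differentiableWithinAt, by simp, ?_⟩
    rw [contDiffOn_zero]
    exact hc.congr fun r hr => (h₂ r hr).deriv
  exact hd.congr fun r hr => (h₁ r hr).deriv

/-- `∫ᵣ¹ dt / (t ^ d φ(t) ^ 2)`. -/
noncomputable def profileTail (d : ℕ) (φ : ℝ → ℝ) (r : ℝ) : ℝ :=
  ∫ t in r..1, (t ^ d * φ t ^ 2)⁻¹

/-- The second solution `ψ` of `ψ'' + (d / r) ψ' = V ψ`, with `ψ'(1) = 0`, obtained from `φ` by
reduction of order. -/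
noncomputable def outerSol (d : ℕ) (φ k : ℝ → ℝ) (r : ℝ) : ℝ :=
  φ r * (1 / radAvg d k 1 + profileTail d φ r)

/-- The derivative of `outerSol`. -/
noncomputable def outerSolDeriv (d : ℕ) (φ k : ℝ → ℝ) (r : ℝ) : ℝ :=
  r * radAvg d k r * (1 / radAvg d k 1 + profileTail d φ r) - (r ^ d * φ r)⁻¹

/-- The Green function, built from the two solutions `φ` and `ψ`. -/
noncomputable def radialGreen (d : ℕ) (φ k : ℝ → ℝ) (r s : ℝ) : ℝ :=
  s ^ d * (φ (min r s) * outerSol d φ k (max r s))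

namespace IsProfile

variable {d : ℕ} {V φ k : ℝ → ℝ}

theorem hasDerivAt_deriv (P : IsProfile d V φ k) {r : ℝ} (hr : r ∈ Ioo (0 : ℝ) 1) :
    HasDerivAt (fun r => r * radAvg d k r) (V r * φ r - d / r * (r * radAvg d k r)) r := by
  have hr0 := hr.1.ne'
  refine ((hasDerivAt_id r).mul (hasDerivAt_radAvg P.cont hr0)).congr_deriv ?_
  rw [← P.source r ⟨hr.1.le, hr.2.le⟩]
  simp only [id]
  field_simp
  ring

theorem weight_pos (P : IsProfile d V φ k) {r : ℝ} (hr : r ∈ Ioc (0 : ℝ) 1) :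
    0 < r ^ d * φ r ^ 2 := by
  have := P.pos r ⟨hr.1.le, hr.2⟩
  have := hr.1
  positivity

theorem hasDerivAt_tail (P : IsProfile d V φ k) {r : ℝ} (hr : r ∈ Ioc (0 : ℝ) 1) :
    HasDerivAt (profileTail d φ) (-(r ^ d * φ r ^ 2)⁻¹) r := by
  have hc := P.continuous
  have hw : Continuous fun t => t ^ d * φ t ^ 2 := by fun_prop
  refine intervalIntegral.integral_hasDerivAt_left ?_
    (hw.measurable.inv.stronglyMeasurable.stronglyMeasurableAtFilter)
    (hw.continuousAt.inv₀ (P.weight_pos hr).ne')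
  refine ContinuousOn.intervalIntegrable ?_
  rw [uIcc_of_le hr.2]
  exact hw.continuousOn.inv₀ fun t ht => (P.weight_pos ⟨hr.1.trans_le ht.1, ht.2⟩).ne'

theorem tail_one : profileTail d φ 1 = 0 := by simp [profileTail]

/-- The integrand dominates 1/t because φ ≤ 1 and t^d ≤ t for d ≥ 1. This singularity excludes the
second solution at the origin. -/
theorem neg_log_le_tail (P : IsProfile d V φ k) (hd : 1 ≤ d) {r : ℝ} (hr : r ∈ Ioc (0 : ℝ) 1) :
    -Real.log r ≤ profileTail d φ r := by
  have hanti : AntitoneOn (fun r => profileTail d φ r + Real.log r) (Icc r 1) := by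
    have hder : ∀ x ∈ Icc r 1, HasDerivAt (fun r => profileTail d φ r + Real.log r)
        (-(x ^ d * φ x ^ 2)⁻¹ + x⁻¹) x := fun x hx =>
      (P.hasDerivAt_tail ⟨hr.1.trans_le hx.1, hx.2⟩).add
        (Real.hasDerivAt_log (hr.1.trans_le hx.1).ne')
    refine antitoneOn_of_deriv_nonpos (convex_Icc _ _)
      (fun x hx => (hder x hx).continuousAt.continuousWithinAt)
      (fun x hx => (hder x (interior_subset hx)).differentiableAt.differentiableWithinAt)
      fun x hx => ?_
    have hx' := interior_subset hx
    have hx0 : 0 < x := hr.1.trans_le hx'.1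
    rw [(hder x hx').deriv]
    have h1 : x ^ d * φ x ^ 2 ≤ x := by
      have e1 : x ^ d ≤ x := by
        simpa using pow_le_pow_of_le_one hx0.le hx'.2 hd
      have e2 : φ x ^ 2 ≤ 1 := pow_le_one₀ (P.pos x ⟨hx0.le, hx'.2⟩).le (P.le_one ⟨hx0.le, hx'.2⟩)
      exact (mul_le_of_le_one_right (by positivity) e2).trans e1
    have := inv_anti₀ (P.weight_pos ⟨hx0, hx'.2⟩) h1
    linarith
  have := hanti ⟨le_rfl, hr.2⟩ ⟨hr.2, le_rfl⟩ hr.2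
  simp only [tail_one, Real.log_one] at this
  linarith

theorem hasDerivAt_outer (P : IsProfile d V φ k) {r : ℝ} (hr : r ∈ Ioc (0 : ℝ) 1) :
    HasDerivAt (outerSol d φ k) (outerSolDeriv d φ k r) r := by
  have hφ := (P.pos r ⟨hr.1.le, hr.2⟩).ne'
  have hr0 := hr.1.ne'
  refine ((P.hasDerivAt r).mul ((P.hasDerivAt_tail hr).const_add _)).congr_deriv ?_
  unfold outerSolDeriv
  field_simp
  ring

theorem hasDerivAt_outerDeriv (P : IsProfile d V φ k) {r : ℝ} (hr : r ∈ Ioo (0 : ℝ) 1) :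
    HasDerivAt (outerSolDeriv d φ k)
      (V r * outerSol d φ k r - d / r * outerSolDeriv d φ k r) r := by
  have hφ := (P.pos r ⟨hr.1.le, hr.2.le⟩).ne'
  have hr0 := hr.1.ne'
  have h1 := (P.hasDerivAt_deriv hr).mul
    ((P.hasDerivAt_tail ⟨hr.1, hr.2.le⟩).const_add (1 / radAvg d k 1))
  have h2 := ((hasDerivAt_pow d r).mul (P.hasDerivAt r)).inv
    (mul_ne_zero (pow_ne_zero _ hr0) hφ)
  refine (h1.sub h2).congr_deriv ?_
  unfold outerSol outerSolDeriv
  rcases d with _ | e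
  · simp
    field_simp
    ring
  · simp only [Nat.add_sub_cancel, Pi.mul_apply, pow_succ]
    push_cast
    have hm := P.slope_pos.ne'
    field_simp
    ring

theorem tail_nonneg (P : IsProfile d V φ k) {r : ℝ} (hr : r ∈ Ioc (0 : ℝ) 1) :
    0 ≤ profileTail d φ r :=
  intervalIntegral.integral_nonneg hr.2 fun _ ht =>
    inv_nonneg.2 (P.weight_pos ⟨hr.1.trans_le ht.1, ht.2⟩).le

theorem outer_pos (P : IsProfile d V φ k) {r : ℝ} (hr : r ∈ Ioc (0 : ℝ) 1) :
    0 < outerSol d φ k r := by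
  have h1 := P.tail_nonneg hr
  have h2 := P.pos r ⟨hr.1.le, hr.2⟩
  have h3 := P.slope_pos
  unfold outerSol
  positivity

theorem outer_one (P : IsProfile d V φ k) : outerSol d φ k 1 = 1 / radAvg d k 1 := by
  simp [outerSol, P.one, tail_one]

/-- The additive constant 1/φ'(1) in ψ is chosen for this: φ'(1) · (1/φ'(1)) cancels the 1 produced
by differentiating the tail. -/
theorem outerDeriv_one (P : IsProfile d V φ k) : outerSolDeriv d φ k 1 = 0 := by
  simp [outerSolDeriv, P.one, tail_one, P.slope_pos.ne']

theorem wronskian (P : IsProfile d V φ k) {r : ℝ} (hr : r ∈ Ioc (0 : ℝ) 1) :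
    r ^ d * (φ r * outerSolDeriv d φ k r - outerSol d φ k r * (r * radAvg d k r)) = -1 := by
  have hφ := (P.pos r ⟨hr.1.le, hr.2⟩).ne'
  have hr0 := hr.1.ne'
  unfold outerSol outerSolDeriv
  field_simp
  ring

theorem continuousOn_outer (P : IsProfile d V φ k) : ContinuousOn (outerSol d φ k) (Ioc 0 1) :=
  fun _ hr => (P.hasDerivAt_outer hr).continuousAt.continuousWithinAt

theorem radialGreen_of_le {r s : ℝ} (h : r ≤ s) :
    radialGreen d φ k r s = s ^ d * outerSol d φ k s * φ r := by
  rw [radialGreen, min_eq_left h, max_eq_right h]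
  ring

theorem radialGreen_of_ge {r s : ℝ} (h : s ≤ r) :
    radialGreen d φ k r s = s ^ d * φ s * outerSol d φ k r := by
  rw [radialGreen, min_eq_right h, max_eq_left h]
  ring

theorem radialGreen_eventuallyEq_left {r s : ℝ} (h : r < s) :
    (fun t => radialGreen d φ k t s) =ᶠ[𝓝 r] fun t => s ^ d * outerSol d φ k s * φ t := by
  filter_upwards [gt_mem_nhds h] with t ht
  exact radialGreen_of_le (le_of_lt ht)

theorem radialGreen_eventuallyEq_right {r s : ℝ} (h : s < r) :
    (fun t => radialGreen d φ k t s) =ᶠ[𝓝 r] fun t => s ^ d * φ s * outerSol d φ k t := by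
  filter_upwards [lt_mem_nhds h] with t ht
  exact radialGreen_of_ge (le_of_lt ht)

theorem tendsto_radialGreen_one (P : IsProfile d V φ k) {r : ℝ} (hr : r ∈ Icc (0 : ℝ) 1) :
    Tendsto (fun s => radialGreen d φ k r s) (𝓝 1) (𝓝 (radialGreen d φ k r 1)) := by
  have hc := P.continuous
  have h1 : ContinuousAt (outerSol d φ k) (max r 1) := by
    rw [max_eq_right hr.2]
    exact (P.hasDerivAt_outer ⟨zero_lt_one, le_rfl⟩).continuousAt
  have h2 : ContinuousAt (fun s => outerSol d φ k (max r s)) 1 :=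
    ContinuousAt.comp (f := fun s => max r s) (x := (1 : ℝ)) h1 (by fun_prop)
  have h3 : ContinuousAt (fun s : ℝ => s ^ d * (φ (min r s) * outerSol d φ k (max r s))) 1 :=
    ContinuousAt.mul (by fun_prop) (ContinuousAt.mul (by fun_prop) h2)
  exact h3

/-- On each side of s the function is a multiple of φ or of ψ. The factor s^d turns the Wronskian
identity into the jump -1. -/
theorem isNeumannGreen_radialGreen (P : IsProfile d V φ k) (hV : ContinuousOn V (Icc 0 1)) :
    IsNeumannGreen (d + 1) V (radialGreen d φ k) := by
  have hc := P.continuous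
  have hVo : ContinuousOn V (Ioo 0 1) := hV.mono Ioo_subset_Icc_self
  have hA : Continuous (radAvg d k) := continuous_radAvg P.cont
  have hinv : ContinuousOn (fun r : ℝ => (d : ℝ) / r) (Ioo 0 1) :=
    continuousOn_const.div continuousOn_id fun r hr => hr.1.ne'
  have hφ2 : ContDiffOn ℝ 2 φ (Ioo 0 1) := by
    refine contDiffOn_two_of_hasDerivAt isOpen_Ioo (fun r _ => P.hasDerivAt r)
      (fun r hr => P.hasDerivAt_deriv hr) ?_
    fun_prop
  have hψ2 : ContDiffOn ℝ 2 (outerSol d φ k) (Ioo 0 1) := by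
    have h1 : ContinuousOn (outerSol d φ k) (Ioo 0 1) :=
      P.continuousOn_outer.mono Ioo_subset_Ioc_self
    have h2 : ContinuousOn (outerSolDeriv d φ k) (Ioo 0 1) := fun r hr =>
      (P.hasDerivAt_outerDeriv hr).continuousAt.continuousWithinAt
    exact contDiffOn_two_of_hasDerivAt isOpen_Ioo
      (fun r hr => P.hasDerivAt_outer ⟨hr.1, hr.2.le⟩)
      (fun r hr => P.hasDerivAt_outerDeriv hr) ((hVo.mul h1).sub (hinv.mul h2))
  have hL : ∀ {r s : ℝ}, r < s → deriv (fun t => radialGreen d φ k t s)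
      =ᶠ[𝓝 r] fun t => s ^ d * outerSol d φ k s * (t * radAvg d k t) := by
    intro r s h
    refine (radialGreen_eventuallyEq_left (d := d) (φ := φ) (k := k) h).deriv.trans
      (Eventually.of_forall fun t => ?_)
    exact ((P.hasDerivAt t).const_mul _).deriv
  have hR : ∀ {r s : ℝ}, s < r → r ∈ Ioo (0 : ℝ) 1 → deriv (fun t => radialGreen d φ k t s)
      =ᶠ[𝓝 r] fun t => s ^ d * φ s * outerSolDeriv d φ k t := by
    intro r s h hr
    refine (radialGreen_eventuallyEq_right (d := d) (φ := φ) (k := k) h).deriv.trans ?_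
    filter_upwards [isOpen_Ioo.mem_nhds hr] with t ht
    exact ((P.hasDerivAt_outer ⟨ht.1, ht.2.le⟩).const_mul _).deriv
  refine ⟨fun s hs => ?_, fun s hs => ?_, fun s hs r hr => ?_, fun s hs => ?_, fun s hs => ?_,
    fun s hs => ?_, fun r hr => ?_⟩
  · have h1 : ContinuousOn (fun r => outerSol d φ k (max r s)) (Icc 0 1) :=
      P.continuousOn_outer.comp (by fun_prop) fun r hr =>
        ⟨hs.1.trans_le (le_max_right _ _), max_le hr.2 hs.2.le⟩
    exact continuousOn_const.mul (ContinuousOn.mul (by fun_prop) h1)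
  · intro r hr
    refine ContDiffAt.contDiffWithinAt ?_
    rcases lt_or_gt_of_ne hr.2 with h | h
    · exact (contDiffAt_const.mul (hφ2.contDiffAt (isOpen_Ioo.mem_nhds hr.1))).congr_of_eventuallyEq
        (radialGreen_eventuallyEq_left h)
    · exact (contDiffAt_const.mul (hψ2.contDiffAt (isOpen_Ioo.mem_nhds hr.1))).congr_of_eventuallyEq
        (radialGreen_eventuallyEq_right h)
  · push_cast
    rcases lt_or_gt_of_ne hr.2 with h | h
    · rw [(hL h).deriv_eq, (hL h).eq_of_nhds, radialGreen_of_le h.le,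
        ((P.hasDerivAt_deriv hr.1).const_mul _).deriv]
      ring
    · rw [(hR h hr.1).deriv_eq, (hR h hr.1).eq_of_nhds, radialGreen_of_ge h.le,
        ((P.hasDerivAt_outerDeriv hr.1).const_mul _).deriv]
      ring
  · refine ⟨s ^ d * outerSol d φ k s * (s * radAvg d k s), s ^ d * φ s * outerSolDeriv d φ k s,
      ?_, ?_, ?_⟩
    · have h1 : Tendsto (fun t => s ^ d * outerSol d φ k s * (t * radAvg d k t)) (𝓝[<] s)
          (𝓝 (s ^ d * outerSol d φ k s * (s * radAvg d k s))) :=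
        (Continuous.tendsto (by fun_prop) s).mono_left nhdsWithin_le_nhds
      refine h1.congr' ?_
      filter_upwards [self_mem_nhdsWithin] with t ht
      exact (hL ht).eq_of_nhds.symm
    · have h1 : Tendsto (fun t => s ^ d * φ s * outerSolDeriv d φ k t) (𝓝[>] s)
          (𝓝 (s ^ d * φ s * outerSolDeriv d φ k s)) :=
        ((P.hasDerivAt_outerDeriv hs).continuousAt.tendsto.const_mul _).mono_left
          nhdsWithin_le_nhds
      refine h1.congr' ?_
      filter_upwards [self_mem_nhdsWithin, nhdsWithin_le_nhds (isOpen_Ioo.mem_nhds hs)]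
        with t ht ht'
      exact (hR ht ht').eq_of_nhds.symm
    · have := P.wronskian ⟨hs.1, hs.2.le⟩
      linarith
  · have h1 := ((P.hasDerivAt 0).const_mul (s ^ d * outerSol d φ k s)).congr_of_eventuallyEq
      (radialGreen_eventuallyEq_left hs.1)
    simpa using h1.hasDerivWithinAt
  · have h1 := ((P.hasDerivAt_outer (r := 1) ⟨zero_lt_one, le_rfl⟩).const_mul
      (s ^ d * φ s)).congr_of_eventuallyEq (radialGreen_eventuallyEq_right hs.2)
    rw [P.outerDeriv_one, mul_zero] at h1
    exact h1.hasDerivWithinAt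
  · exact (P.tendsto_radialGreen_one hr).mono_left nhdsWithin_le_nhds

end IsProfile

/-! ### Uniqueness of the Green function and its diagonal -/

namespace IsProfile

variable {d : ℕ} {V φ k g : ℝ → ℝ}

/-- A solution of the homogeneous equation on an interval has the form `φ (K - c τ)`, with `τ` the
tail integral of `φ`. -/
theorem exists_ratio_eq (P : IsProfile d V φ k) {x y : ℝ} (hxy : Ioo x y ⊆ Ioo 0 1)
    (hg : ContDiffOn ℝ 2 g (Ioo x y))
    (heq : ∀ r ∈ Ioo x y, -deriv (deriv g) r - d / r * deriv g r + V r * g r = 0) :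
    ∃ c K, ∀ r ∈ Ioo x y, g r / φ r = K - c * profileTail d φ r := by
  have h1 : ∀ r ∈ Ioo x y, HasDerivAt g (deriv g r) r := fun r hr =>
    ((hg.differentiableOn two_ne_zero).differentiableAt (isOpen_Ioo.mem_nhds hr)).hasDerivAt
  have h2 : ∀ r ∈ Ioo x y, HasDerivAt (deriv g) (deriv (deriv g) r) r := fun r hr =>
    (((contDiffOn_succ_iff_deriv_of_isOpen (n := 1) isOpen_Ioo).1
      (by simpa [one_add_one_eq_two] using hg)).2.2.differentiableOn one_ne_zero).differentiableAt
      (isOpen_Ioo.mem_nhds hr) |>.hasDerivAt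
  have hw : ∀ r ∈ Ioo x y, HasDerivAt
      (fun r => r ^ d * (deriv g r * φ r - g r * (r * radAvg d k r))) 0 r := by
    intro r hr
    have hr' := hxy hr
    have hr0 := hr'.1.ne'
    have e1 := ((h2 r hr).mul (P.hasDerivAt r)).sub ((h1 r hr).mul (P.hasDerivAt_deriv hr'))
    refine ((hasDerivAt_pow d r).mul e1).congr_deriv ?_
    have e2 : deriv (deriv g) r = V r * g r - d / r * deriv g r := by linarith [heq r hr]
    simp only [Pi.sub_apply, Pi.mul_apply, e2]
    rcases d with _ | e
    · simp
      ring
    · simp only [Nat.add_sub_cancel, pow_succ]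
      push_cast
      field_simp
      ring
  -- The weighted Wronskian of g and φ is a constant c, so (g/φ)' = c/(r^d φ²) integrates to a
  -- multiple of the tail.
  obtain ⟨c, hc⟩ := isOpen_Ioo.exists_is_const_of_deriv_eq_zero isPreconnected_Ioo
    (fun r hr => (hw r hr).differentiableAt.differentiableWithinAt) fun r hr => (hw r hr).deriv
  have hq : ∀ r ∈ Ioo x y, HasDerivAt (fun r => g r / φ r + c * profileTail d φ r) 0 r := by
    intro r hr
    have hr' := hxy hr
    have hr0 := hr'.1.ne'
    have hφ := (P.pos r ⟨hr'.1.le, hr'.2.le⟩).ne'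
    refine (((h1 r hr).div (P.hasDerivAt r) hφ).add
      ((P.hasDerivAt_tail ⟨hr'.1, hr'.2.le⟩).const_mul c)).congr_deriv ?_
    rw [← hc r hr]
    field_simp
    ring
  obtain ⟨K, hK⟩ := isOpen_Ioo.exists_is_const_of_deriv_eq_zero isPreconnected_Ioo
    (fun r hr => (hq r hr).differentiableAt.differentiableWithinAt) fun r hr => (hq r hr).deriv
  exact ⟨c, K, fun r hr => by linarith [hK r hr]⟩

/-- The bounded solutions near the origin are the multiples of `φ`. -/
theorem exists_eq_mul_left (P : IsProfile d V φ k) (hd : 1 ≤ d) {s : ℝ} (hs : s ∈ Ioo (0 : ℝ) 1)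
    (hgc : ContinuousOn g (Icc 0 s)) (hg : ContDiffOn ℝ 2 g (Ioo 0 s))
    (heq : ∀ r ∈ Ioo 0 s, -deriv (deriv g) r - d / r * deriv g r + V r * g r = 0) :
    ∃ A, ∀ r ∈ Icc 0 s, g r = A * φ r := by
  have hsub : Icc 0 s ⊆ Icc (0 : ℝ) 1 := Icc_subset_Icc_right hs.2.le
  obtain ⟨c, K, hK⟩ := P.exists_ratio_eq (Ioo_subset_Ioo_right hs.2.le) hg heq
  have hqc : ContinuousOn (fun r => g r / φ r) (Icc 0 s) :=
    hgc.div P.continuous.continuousOn fun r hr => (P.pos r (hsub hr)).ne'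
  obtain ⟨B, hB⟩ := isCompact_Icc.exists_bound_of_continuousOn hqc
  have hc0 : c = 0 := by
    by_contra hc
    have hlim : Tendsto (fun r => |c| * -Real.log r) (𝓝[>] 0) atTop :=
      (tendsto_neg_atBot_atTop.comp Real.tendsto_log_nhdsGT_zero).const_mul_atTop (abs_pos.2 hc)
    obtain ⟨r, h1, h2⟩ := ((hlim.eventually_gt_atTop (|K| + B)).and
      (Ioo_mem_nhdsGT hs.1)).exists
    have h3 := P.neg_log_le_tail hd ⟨h2.1, h2.2.le.trans hs.2.le⟩
    have h4 := hB r ⟨h2.1.le, h2.2.le⟩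
    rw [Real.norm_eq_abs, hK r h2] at h4
    have h5 : |c| * -Real.log r ≤ |c * profileTail d φ r| := by
      rw [abs_mul]
      exact mul_le_mul_of_nonneg_left (h3.trans (le_abs_self _)) (abs_nonneg _)
    have h6 : |c * profileTail d φ r| ≤ |K| + |K - c * profileTail d φ r| := by
      have := abs_sub K (K - c * profileTail d φ r)
      rwa [sub_sub_cancel] at this
    linarith
  refine ⟨K, fun r hr => ?_⟩
  have hEq : EqOn (fun r => g r / φ r) (fun _ => K) (Icc 0 s) :=
    EqOn.of_subset_closure (s := Ioo 0 s) (fun r hr => by simp [hK r hr, hc0]) hqc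
      continuousOn_const Ioo_subset_Icc_self (closure_Ioo hs.1.ne).ge
  have := hEq hr
  have hφ := P.pos r (hsub hr)
  field_simp at this
  linarith

/-- The solutions near `1` with vanishing derivative at `1` are the multiples of `ψ`. -/
theorem exists_eq_mul_right (P : IsProfile d V φ k) {s : ℝ} (hs : s ∈ Ioo (0 : ℝ) 1)
    (hgc : ContinuousOn g (Icc s 1)) (hg : ContDiffOn ℝ 2 g (Ioo s 1))
    (heq : ∀ r ∈ Ioo s 1, -deriv (deriv g) r - d / r * deriv g r + V r * g r = 0)
    (hg1 : HasDerivWithinAt g 0 (Icc s 1) 1) :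
    ∃ B, ∀ r ∈ Icc s 1, g r = B * outerSol d φ k r := by
  have hsub : Icc s 1 ⊆ Ioc (0 : ℝ) 1 := fun r hr => ⟨hs.1.trans_le hr.1, hr.2⟩
  obtain ⟨c, K, hK⟩ := P.exists_ratio_eq (Ioo_subset_Ioo_left hs.1.le) hg heq
  have hφ : ∀ r ∈ Icc s 1, φ r ≠ 0 := fun r hr => (P.pos r ⟨(hsub hr).1.le, hr.2⟩).ne'
  have hqc : ContinuousOn (fun r => g r / φ r) (Icc s 1) :=
    hgc.div P.continuous.continuousOn hφ
  have htc : ContinuousOn (profileTail d φ) (Icc s 1) := fun r hr =>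
    (P.hasDerivAt_tail (hsub hr)).continuousAt.continuousWithinAt
  have hEq : EqOn (fun r => g r / φ r) (fun r => K - c * profileTail d φ r) (Icc s 1) :=
    EqOn.of_subset_closure (s := Ioo s 1) hK hqc
      (continuousOn_const.sub (continuousOn_const.mul htc)) Ioo_subset_Icc_self
      (closure_Ioo hs.2.ne).ge
  have hEq' : ∀ r ∈ Icc s 1, g r = φ r * (K - c * profileTail d φ r) := fun r hr => by
    have h1 := hEq hr
    have h2 := hφ r hr
    simp only at h1
    rw [← h1]
    field_simp
  have h1I : (1 : ℝ) ∈ Icc s 1 := ⟨hs.2.le, le_rfl⟩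
  have hder := ((P.hasDerivAt 1).mul
    ((P.hasDerivAt_tail (hsub h1I)).const_mul c |>.const_sub K)).hasDerivWithinAt (s := Icc s 1)
  have huniq := (uniqueDiffOn_Icc hs.2 1 h1I).eq_deriv _ hg1 (hder.congr hEq' (hEq' 1 h1I))
  simp [tail_one, P.one] at huniq
  -- The condition g'(1) = 0 reads Kφ'(1) + c = 0, which is the combination defining ψ.
  refine ⟨K * radAvg d k 1, fun r hr => ?_⟩
  have hm := P.slope_pos.ne'
  have hc : c = -(K * radAvg d k 1) := by linarith
  rw [hEq' r hr, outerSol, hc]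
  field_simp
  ring

/-- The two factors on either side of s solve a linear system given by continuity and the jump; the
Wronskian is its determinant up to a power of s. -/
theorem green_eq_of_lt_one (P : IsProfile d V φ k) (hd : 1 ≤ d) {G : ℝ → ℝ → ℝ}
    (hG : IsNeumannGreen (d + 1) V G) {r s : ℝ} (hs : s ∈ Ioo (0 : ℝ) 1)
    (hr : r ∈ Icc (0 : ℝ) 1) : G r s = radialGreen d φ k r s := by
  have heq : ∀ r ∈ Ioo (0 : ℝ) 1 \ {s}, -deriv (deriv fun t => G t s) r
      - d / r * deriv (fun t => G t s) r + V r * G r s = 0 := fun r hr => by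
    have := hG.equation s hs r hr
    push_cast at this
    rwa [add_sub_cancel_right] at this
  have hL : Ioo 0 s ⊆ Ioo (0 : ℝ) 1 \ {s} := fun t ht => ⟨⟨ht.1, ht.2.trans hs.2⟩, ht.2.ne⟩
  have hR : Ioo s 1 ⊆ Ioo (0 : ℝ) 1 \ {s} := fun t ht => ⟨⟨hs.1.trans ht.1, ht.2⟩, ht.1.ne'⟩
  obtain ⟨A, hA⟩ := P.exists_eq_mul_left hd hs
    ((hG.continuousOn s hs).mono (Icc_subset_Icc_right hs.2.le))
    ((hG.contDiffOn s hs).mono hL) (fun r hr => heq r (hL hr))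
  obtain ⟨B, hB⟩ := P.exists_eq_mul_right hs
    ((hG.continuousOn s hs).mono (Icc_subset_Icc_left hs.1.le))
    ((hG.contDiffOn s hs).mono hR) (fun r hr => heq r (hR hr))
    ((hG.deriv_one s hs).mono (Icc_subset_Icc_left hs.1.le))
  have hsI : s ∈ Ioc (0 : ℝ) 1 := ⟨hs.1, hs.2.le⟩
  have hmatch : A * φ s = B * outerSol d φ k s :=
    (hA s ⟨hs.1.le, le_rfl⟩).symm.trans (hB s ⟨le_rfl, hs.2.le⟩)
  obtain ⟨a, b, ha, hb, hab⟩ := hG.jump s hs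
  have hcA : Continuous (radAvg d k) := continuous_radAvg P.cont
  have ha' : a = A * (s * radAvg d k s) := by
    refine tendsto_nhds_unique ha ?_
    have h1 : Tendsto (fun t => A * (t * radAvg d k t)) (𝓝[<] s)
        (𝓝 (A * (s * radAvg d k s))) :=
      (Continuous.tendsto (by fun_prop) s).mono_left nhdsWithin_le_nhds
    refine h1.congr' ?_
    filter_upwards [Ioo_mem_nhdsLT hs.1] with t ht
    have h2 : (fun t => G t s) =ᶠ[𝓝 t] fun t => A * φ t := by
      filter_upwards [isOpen_Ioo.mem_nhds ht] with x hx
      exact hA x ⟨hx.1.le, hx.2.le⟩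
    rw [h2.deriv_eq, ((P.hasDerivAt t).const_mul A).deriv]
  have hb' : b = B * outerSolDeriv d φ k s := by
    refine tendsto_nhds_unique hb ?_
    have h1 : Tendsto (fun t => B * outerSolDeriv d φ k t) (𝓝[>] s)
        (𝓝 (B * outerSolDeriv d φ k s)) :=
      ((P.hasDerivAt_outerDeriv hs).continuousAt.tendsto.const_mul _).mono_left
        nhdsWithin_le_nhds
    refine h1.congr' ?_
    filter_upwards [Ioo_mem_nhdsGT hs.2] with t ht
    have h2 : (fun t => G t s) =ᶠ[𝓝 t] fun t => B * outerSol d φ k t := by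
      filter_upwards [isOpen_Ioo.mem_nhds ht] with x hx
      exact hB x ⟨hx.1.le, hx.2.le⟩
    rw [h2.deriv_eq, ((P.hasDerivAt_outer ⟨hs.1.trans ht.1, ht.2.le⟩).const_mul B).deriv]
  have hw := P.wronskian hsI
  have hφ := (P.pos s ⟨hs.1.le, hs.2.le⟩).ne'
  rw [ha', hb'] at hab
  have hBv : B = s ^ d * φ s := by
    have h1 : B * (φ s * outerSolDeriv d φ k s - outerSol d φ k s * (s * radAvg d k s))
        = -φ s := by
      linear_combination φ s * hab + s * radAvg d k s * hmatch
    have h2 : B * (s ^ d * (φ s * outerSolDeriv d φ k s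
        - outerSol d φ k s * (s * radAvg d k s))) = -(s ^ d * φ s) := by
      linear_combination s ^ d * h1
    rw [hw] at h2
    linarith
  have hAv : A = s ^ d * outerSol d φ k s := by
    refine mul_right_cancel₀ hφ ?_
    rw [hmatch, hBv]
    ring
  rcases le_total r s with h | h
  · rw [hA r ⟨hr.1, h⟩, radialGreen_of_le h, hAv]
  · rw [hB r ⟨h, hr.2⟩, radialGreen_of_ge h, hBv]

/-- The Green function is unique. -/
theorem green_eq (P : IsProfile d V φ k) (hd : 1 ≤ d) {G : ℝ → ℝ → ℝ}
    (hG : IsNeumannGreen (d + 1) V G) {r s : ℝ} (hs : s ∈ Ioc (0 : ℝ) 1)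
    (hr : r ∈ Icc (0 : ℝ) 1) : G r s = radialGreen d φ k r s := by
  rcases hs.2.eq_or_lt with rfl | hlt
  · refine tendsto_nhds_unique (hG.tendsto_one r hr) ?_
    refine ((P.tendsto_radialGreen_one hr).mono_left nhdsWithin_le_nhds).congr' ?_
    filter_upwards [Ioo_mem_nhdsLT zero_lt_one] with t ht
    exact (P.green_eq_of_lt_one hd hG ht hr).symm
  · exact P.green_eq_of_lt_one hd hG ⟨hs.1, hlt⟩ hr

/-- For s = 1 the whole interval lies left of the pole, so G(·,1) is a multiple of φ. -/
theorem green_one_div (P : IsProfile d V φ k) (hd : 1 ≤ d) {G : ℝ → ℝ → ℝ}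
    (hG : IsNeumannGreen (d + 1) V G) {r : ℝ} (hr : r ∈ Icc (0 : ℝ) 1) :
    G r 1 / G 1 1 = φ r := by
  have hm := P.slope_pos.ne'
  have h1 : (1 : ℝ) ∈ Ioc (0 : ℝ) 1 := ⟨zero_lt_one, le_rfl⟩
  rw [P.green_eq hd hG h1 hr, P.green_eq hd hG h1 ⟨zero_le_one, le_rfl⟩, radialGreen_of_le hr.2,
    radialGreen_of_le le_rfl, P.outer_one, P.one]
  field_simp

theorem green_diag (P : IsProfile d V φ k) (hd : 1 ≤ d) {G : ℝ → ℝ → ℝ}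
    (hG : IsNeumannGreen (d + 1) V G) {r : ℝ} (hr : r ∈ Ioc (0 : ℝ) 1) :
    G r r = r ^ d * (φ r * outerSol d φ k r) := by
  rw [P.green_eq hd hG hr ⟨hr.1.le, hr.2⟩, radialGreen, min_self, max_self]

theorem green_diag_pos (P : IsProfile d V φ k) (hd : 1 ≤ d) {G : ℝ → ℝ → ℝ}
    (hG : IsNeumannGreen (d + 1) V G) {r : ℝ} (hr : r ∈ Ioc (0 : ℝ) 1) : 0 < G r r := by
  rw [P.green_diag hd hG hr]
  exact mul_pos (pow_pos hr.1 _) (mul_pos (P.pos r ⟨hr.1.le, hr.2⟩) (P.outer_pos hr))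

theorem energyF_eq (P : IsProfile d V φ k) (hd : 1 ≤ d) {G : ℝ → ℝ → ℝ}
    (hG : IsNeumannGreen (d + 1) V G) {r : ℝ} (hr : r ∈ Ioc (0 : ℝ) 1) :
    energyF (d + 1) G r = sphereArea (d + 1) / (φ r * outerSol d φ k r) := by
  have h1 := P.pos r ⟨hr.1.le, hr.2⟩
  have h2 := P.outer_pos hr
  have h3 := hr.1
  rw [energyF, P.green_diag hd hG hr, Nat.add_sub_cancel]
  field_simp

end IsProfile

/-! ### Behaviour of F at the boundary -/

theorem sphereArea_pos (d : ℕ) : 0 < sphereArea (d + 1) := by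
  rw [sphereArea, Measure.toSphere_real_apply_univ]
  refine mul_pos (by simp only [finrank_euclideanSpace, Fintype.card_fin]; positivity) ?_
  exact ENNReal.toReal_pos (isOpen_ball.measure_pos volume ⟨0, by simp⟩).ne'
    measure_ball_lt_top.ne

namespace IsProfile

variable {d : ℕ} {V φ k : ℝ → ℝ}

theorem hasDerivAt_energy (P : IsProfile d V φ k) {r : ℝ} (hr : r ∈ Ioc (0 : ℝ) 1) :
    HasDerivAt (fun r => sphereArea (d + 1) / (φ r * outerSol d φ k r))
      (-(sphereArea (d + 1) * (r * radAvg d k r * outerSol d φ k r + φ r * outerSolDeriv d φ k r))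
        / (φ r * outerSol d φ k r) ^ 2) r := by
  have h1 := P.pos r ⟨hr.1.le, hr.2⟩
  have h2 := P.outer_pos hr
  refine ((hasDerivAt_const r (sphereArea (d + 1))).div
    ((P.hasDerivAt r).mul (P.hasDerivAt_outer hr)) (mul_pos h1 h2).ne').congr_deriv ?_
  simp

theorem tendsto_deriv_energyF (P : IsProfile d V φ k) (hd : 1 ≤ d) {G : ℝ → ℝ → ℝ}
    (hG : IsNeumannGreen (d + 1) V G) :
    Tendsto (deriv (energyF (d + 1) G)) (𝓝[<] 1)
      (𝓝 (-(sphereArea (d + 1) * radAvg d k 1 ^ 2))) := by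
  have h1 : (1 : ℝ) ∈ Ioc (0 : ℝ) 1 := ⟨zero_lt_one, le_rfl⟩
  have hm := P.slope_pos.ne'
  have c1 : ContinuousAt (outerSol d φ k) 1 := (P.hasDerivAt_outer h1).continuousAt
  have c2 : ContinuousAt (profileTail d φ) 1 := (P.hasDerivAt_tail h1).continuousAt
  have c3 : ContinuousAt φ 1 := P.continuous.continuousAt
  have c4 : ContinuousAt (radAvg d k) 1 := (continuous_radAvg P.cont).continuousAt
  have c5 : ContinuousAt (outerSolDeriv d φ k) 1 := by
    have : ContinuousAt (fun r : ℝ => (r ^ d * φ r)⁻¹) 1 :=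
      ContinuousAt.inv₀ (by fun_prop) (by simp [P.one])
    unfold outerSolDeriv
    fun_prop
  have hden : (φ 1 * outerSol d φ k 1) ^ 2 ≠ 0 := by simp [P.one, P.outer_one, hm]
  have hc : ContinuousAt (fun r => -(sphereArea (d + 1) * (r * radAvg d k r * outerSol d φ k r
      + φ r * outerSolDeriv d φ k r)) / (φ r * outerSol d φ k r) ^ 2) 1 :=
    ContinuousAt.div (by fun_prop) (by fun_prop) hden
  have hlim := hc.tendsto.mono_left (nhdsWithin_le_nhds (s := Iio 1))
  have hval : -(sphereArea (d + 1) * (1 * radAvg d k 1 * outerSol d φ k 1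
      + φ 1 * outerSolDeriv d φ k 1)) / (φ 1 * outerSol d φ k 1) ^ 2
      = -(sphereArea (d + 1) * radAvg d k 1 ^ 2) := by
    rw [P.outerDeriv_one, P.one, P.outer_one]
    field_simp
    ring
  rw [hval] at hlim
  refine hlim.congr' ?_
  filter_upwards [Ioo_mem_nhdsLT zero_lt_one] with r hr
  have he : energyF (d + 1) G =ᶠ[𝓝 r]
      fun r => sphereArea (d + 1) / (φ r * outerSol d φ k r) := by
    filter_upwards [isOpen_Ioo.mem_nhds hr] with x hx
    exact P.energyF_eq hd hG ⟨hx.1, hx.2.le⟩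
  rw [he.deriv_eq, (P.hasDerivAt_energy ⟨hr.1, hr.2.le⟩).deriv]

/-- F is continuous up to 1 and F' is negative on some (l,1), so F decreases towards its value at 1.
-/
theorem isLocalMinOn_energyF (P : IsProfile d V φ k) (hd : 1 ≤ d) {G : ℝ → ℝ → ℝ}
    (hG : IsNeumannGreen (d + 1) V G) : IsLocalMinOn (energyF (d + 1) G) (Ioc 0 1) 1 := by
  have hneg : -(sphereArea (d + 1) * radAvg d k 1 ^ 2) < 0 :=
    neg_neg_of_pos (mul_pos (sphereArea_pos d) (pow_pos P.slope_pos 2))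
  have hev := (P.tendsto_deriv_energyF hd hG).eventually (gt_mem_nhds hneg)
  obtain ⟨l, hl, hsub⟩ := (mem_nhdsLT_iff_exists_Ioo_subset).1 hev
  set l' := max l (1 / 2) with hl'
  have hl1 : l' < 1 := max_lt hl (by norm_num)
  have hl0 : 0 < l' := lt_of_lt_of_le (by norm_num) (le_max_right l (1 / 2))
  have hpos : ∀ {x}, x ∈ Icc l' 1 → x ∈ Ioc (0 : ℝ) 1 := fun hx => ⟨hl0.trans_le hx.1, hx.2⟩
  have hanti : AntitoneOn (energyF (d + 1) G) (Icc l' 1) := by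
    refine antitoneOn_of_deriv_nonpos (convex_Icc _ _) ?_ ?_ ?_
    · have : ContinuousOn (fun r => sphereArea (d + 1) / (φ r * outerSol d φ k r)) (Icc l' 1) :=
        fun x hx => (P.hasDerivAt_energy (hpos hx)).continuousAt.continuousWithinAt
      exact this.congr fun x hx => P.energyF_eq hd hG (hpos hx)
    · intro x hx
      rw [interior_Icc] at hx ⊢
      have : DifferentiableWithinAt ℝ (fun r => sphereArea (d + 1) / (φ r * outerSol d φ k r))
          (Ioo l' 1) x :=
        (P.hasDerivAt_energy
          (hpos (Ioo_subset_Icc_self hx))).differentiableAt.differentiableWithinAt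
      exact this.congr (fun y hy => P.energyF_eq hd hG (hpos (Ioo_subset_Icc_self hy)))
        (P.energyF_eq hd hG (hpos (Ioo_subset_Icc_self hx)))
    · intro x hx
      rw [interior_Icc] at hx
      exact le_of_lt (hsub ⟨(le_max_left _ _).trans_lt hx.1, hx.2⟩)
  filter_upwards [self_mem_nhdsWithin, nhdsWithin_le_nhds (lt_mem_nhds hl1)] with r hr hr'
  exact hanti ⟨le_of_lt hr', hr.2⟩ ⟨hl1.le, le_rfl⟩ hr.2

end IsProfile

/-! ### Radial functions in space: gradient and Laplacian -/

section RadialFunctions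

variable {E : Type*} [NormedAddCommGroup E] [InnerProductSpace ℝ E] {d : ℕ} {h : ℝ → ℝ}

/-- The real inner product as a continuous bilinear map, linear in both arguments. -/
noncomputable def innerBilin (E : Type*) [NormedAddCommGroup E] [InnerProductSpace ℝ E] :
    E →L[ℝ] E →L[ℝ] ℝ :=
  (innerₗ E).mkContinuous₂ 1 fun x y => by
    rw [one_mul]
    exact norm_inner_le_norm x y

theorem innerBilin_apply (x y : E) : innerBilin E x y = inner ℝ x y := rfl

theorem norm_innerBilin_le (x : E) : ‖innerBilin E x‖ ≤ ‖x‖ :=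
  ContinuousLinearMap.opNorm_le_bound _ (norm_nonneg _) fun y => norm_inner_le_norm x y

theorem hasFDerivAt_norm_of_ne {x : E} (hx : x ≠ 0) :
    HasFDerivAt (fun y : E => ‖y‖) (‖x‖⁻¹ • innerBilin E x) x := by
  have hx' : ‖x‖ ≠ 0 := norm_ne_zero_iff.2 hx
  have h1 := ((hasFDerivAt_id x).norm_sq).sqrt (by simpa using hx)
  simp only [id, Real.sqrt_sq (norm_nonneg _)] at h1
  refine h1.congr_fderiv ?_
  ext y
  simp only [smul_apply, ContinuousLinearMap.comp_apply, nsmul_eq_mul,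
    smul_eq_mul, innerBilin_apply, innerSL_apply_apply, ContinuousLinearMap.id_apply]
  field_simp
  norm_num

/-- The gradient of the radial potential. -/
noncomputable def radField (d : ℕ) (h : ℝ → ℝ) (x : E) : E := radAvg d h ‖x‖ • x

theorem continuous_radField (hh : Continuous h) : Continuous (radField d h : E → E) :=
  ((continuous_radAvg hh).comp continuous_norm).smul continuous_id

/-- Away from 0 this is the chain rule. At 0 the norm is not differentiable, but `radPot` has zero
slope there, so the difference is o(‖x‖). -/
theorem hasFDerivAt_radPot_norm (hh : Continuous h) (c : ℝ) (x : E) :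
    HasFDerivAt (fun y : E => c + radPot d h ‖y‖) (innerBilin E (radField d h x)) x := by
  refine HasFDerivAt.const_add c ?_
  rcases eq_or_ne x 0 with rfl | hx
  · have h1 := hasDerivAt_radPot (d := d) hh 0
    rw [zero_mul, hasDerivAt_iff_isLittleO] at h1
    have h2 : Tendsto (fun y : E => ‖y‖) (𝓝 0) (𝓝 0) := by
      simpa using (continuous_norm (E := E)).tendsto 0
    have h3 := h1.comp_tendsto h2
    rw [hasFDerivAt_iff_isLittleO]
    refine (h3.congr_left fun y => ?_).trans_isBigO ?_
    · simp [radField]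
    · refine Asymptotics.IsBigO.of_bound 1 (Eventually.of_forall fun y => ?_)
      simp
  · refine ((hasDerivAt_radPot (d := d) hh ‖x‖).comp_hasFDerivAt x
      (hasFDerivAt_norm_of_ne hx)).congr_fderiv ?_
    have hx' : ‖x‖ ≠ 0 := norm_ne_zero_iff.2 hx
    ext y
    simp only [radField, map_smul, smul_apply, smul_eq_mul]
    field_simp

/-- The derivative of `radField`. -/
noncomputable def radFieldDeriv (d : ℕ) (h : ℝ → ℝ) (x : E) : E →L[ℝ] E :=
  radAvg d h ‖x‖ • ContinuousLinearMap.id ℝ E +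
    (((h ‖x‖ - (d + 1) * radAvg d h ‖x‖) / ‖x‖ ^ 2) • innerBilin E x).smulRight x

theorem hasFDerivAt_radField (hh : Continuous h) (x : E) :
    HasFDerivAt (radField d h : E → E) (radFieldDeriv d h x) x := by
  rcases eq_or_ne x 0 with rfl | hx
  · rw [hasFDerivAt_iff_isLittleO]
    have h1 : Tendsto (fun y : E => radAvg d h ‖y‖ - radAvg d h 0) (𝓝 0) (𝓝 0) := by
      have hA := continuous_radAvg (d := d) hh
      have hc : Continuous fun y : E => radAvg d h ‖y‖ - radAvg d h 0 := by fun_prop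
      simpa using hc.tendsto 0
    have h2 := ((Asymptotics.isLittleO_one_iff ℝ).2 h1).smul_isBigO
      (Asymptotics.isBigO_refl (fun y : E => y) (𝓝 0))
    refine h2.congr (fun y => ?_) fun y => ?_
    · simp [radField, radFieldDeriv, sub_smul]
    · simp
  · have hx' : ‖x‖ ≠ 0 := norm_ne_zero_iff.2 hx
    have h1 := (hasDerivAt_radAvg (d := d) hh hx').comp_hasFDerivAt x (hasFDerivAt_norm_of_ne hx)
    refine (h1.fun_smul (hasFDerivAt_id x)).congr_fderiv ?_
    ext1 y
    simp only [radFieldDeriv, Function.comp_apply, add_apply,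
      smul_apply, ContinuousLinearMap.smulRight_apply, id, smul_eq_mul]
    congr 2
    field_simp

/-- Only the origin matters: the rank-one part has norm at most |h - (d+1) radAvg|, which tends to 0
since the average at 0 is h(0)/(d+1). -/
theorem continuous_radFieldDeriv (hh : Continuous h) :
    Continuous (radFieldDeriv d h : E → E →L[ℝ] E) := by
  have hA := continuous_radAvg (d := d) hh
  have c1 : Continuous fun x : E => radAvg d h ‖x‖ • ContinuousLinearMap.id ℝ E :=
    (hA.comp continuous_norm).smul continuous_const
  refine c1.add (continuous_iff_continuousAt.2 fun x => ?_)
  rcases eq_or_ne x 0 with rfl | hx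
  · have hlim : Tendsto (fun x : E => |h ‖x‖ - (d + 1) * radAvg d h ‖x‖|) (𝓝 0) (𝓝 0) := by
      have hc : Continuous fun x : E => |h ‖x‖ - (d + 1) * radAvg d h ‖x‖| := by fun_prop
      have := hc.tendsto 0
      have h0 : (d : ℝ) + 1 ≠ 0 := by positivity
      simpa [radAvg_zero, mul_div_cancel₀, h0] using this
    have hz : (((h ‖(0 : E)‖ - (d + 1) * radAvg d h ‖(0 : E)‖) / ‖(0 : E)‖ ^ 2)
        • innerBilin E 0).smulRight (0 : E) = 0 := by simp
    rw [ContinuousAt, hz]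
    refine squeeze_zero_norm (fun x => ?_) hlim
    rw [ContinuousLinearMap.norm_smulRight_apply, norm_smul, norm_div, norm_pow, norm_norm,
      Real.norm_eq_abs]
    rcases eq_or_ne x 0 with rfl | hx
    · simp
    · have hx' : 0 < ‖x‖ := norm_pos_iff.2 hx
      calc _ ≤ |h ‖x‖ - (d + 1) * radAvg d h ‖x‖| / ‖x‖ ^ 2 * ‖x‖ * ‖x‖ := by
            gcongr
            exact norm_innerBilin_le x
        _ = |h ‖x‖ - (d + 1) * radAvg d h ‖x‖| := by field_simp
  · have hx' : ‖x‖ ^ 2 ≠ 0 := pow_ne_zero _ (norm_ne_zero_iff.2 hx)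
    have c2 : ContinuousAt (fun x : E => (h ‖x‖ - (d + 1) * radAvg d h ‖x‖) / ‖x‖ ^ 2) x :=
      ContinuousAt.div (by fun_prop) (by fun_prop) hx'
    have c3 : ContinuousAt (fun x : E =>
        ((h ‖x‖ - (d + 1) * radAvg d h ‖x‖) / ‖x‖ ^ 2) • innerBilin E x) x :=
      c2.smul (innerBilin E).continuous.continuousAt
    exact ((ContinuousLinearMap.smulRightL ℝ E E).continuous₂.continuousAt).comp
      (c3.prodMk continuousAt_id)

theorem fderiv_radPot_norm (hh : Continuous h) (c : ℝ) :
    fderiv ℝ (fun y : E => c + radPot d h ‖y‖) = fun x => innerBilin E (radField d h x) :=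
  funext fun x => (hasFDerivAt_radPot_norm hh c x).fderiv

theorem contDiff_two_radPot_norm (hh : Continuous h) (c : ℝ) :
    ContDiff ℝ 2 fun y : E => c + radPot d h ‖y‖ := by
  have hX : ContDiff ℝ 1 (radField d h : E → E) :=
    contDiff_one_iff_hasFDerivAt.2 ⟨_, continuous_radFieldDeriv hh, hasFDerivAt_radField hh⟩
  have := (contDiff_succ_iff_hasFDerivAt (n := 1) (f := fun y : E => c + radPot d h ‖y‖)).2
    ⟨fun x => innerBilin E (radField d h x), (innerBilin E).contDiff.comp hX, hasFDerivAt_radPot_norm hh c⟩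
  simpa [one_add_one_eq_two] using this

/-- The trace of the field's derivative is (d+1) radAvg from the identity plus h - (d+1) radAvg from
the rank-one part. -/
theorem laplacian_radPot_norm [FiniteDimensional ℝ E] (hE : Module.finrank ℝ E = d + 1)
    (hh : Continuous h) (c : ℝ) (x : E) :
    Laplacian.laplacian (fun y : E => c + radPot d h ‖y‖) x = h ‖x‖ := by
  have hb := InnerProductSpace.laplacian_eq_iteratedFDeriv_orthonormalBasis
    (fun y : E => c + radPot d h ‖y‖) (stdOrthonormalBasis ℝ E)
  rw [hb]
  have h2 : fderiv ℝ (fun x : E => innerBilin E (radField d h x)) x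
      = (innerBilin E).comp (radFieldDeriv d h x) :=
    ((innerBilin E).hasFDerivAt.comp x (hasFDerivAt_radField hh x)).fderiv
  simp only [iteratedFDeriv_two_apply, fderiv_radPot_norm hh c, h2]
  set b := stdOrthonormalBasis ℝ E
  have h3 : ∀ i, inner ℝ (radFieldDeriv d h x (b i)) (b i) = radAvg d h ‖x‖
      + (h ‖x‖ - (d + 1) * radAvg d h ‖x‖) / ‖x‖ ^ 2 * (inner ℝ x (b i) * inner ℝ (b i) x) := by
    intro i
    simp only [radFieldDeriv, add_apply, smul_apply,
      ContinuousLinearMap.smulRight_apply, inner_add_left, real_inner_smul_left,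
      ContinuousLinearMap.id_apply, innerBilin_apply, real_inner_self_eq_norm_sq,
      b.norm_eq_one, real_inner_comm x (b i), smul_eq_mul]
    ring
  have h4 : ∑ i, inner ℝ (radFieldDeriv d h x (b i)) (b i) = h ‖x‖ := by
    simp only [h3, Finset.sum_add_distrib, ← Finset.mul_sum, b.sum_inner_mul_inner,
      real_inner_self_eq_norm_sq, Finset.sum_const, Finset.card_univ, Fintype.card_fin, hE,
      nsmul_eq_mul]
    push_cast
    rcases eq_or_ne x 0 with rfl | hx
    · simp [radAvg_zero]
      field_simp
    · have hx' : ‖x‖ ≠ 0 := norm_ne_zero_iff.2 hx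
      field_simp
      ring
  exact h4

end RadialFunctions

/-! ### Weak gradients -/

section WeakGradient

variable {n : ℕ}

theorem Continuous.memLp_restrict_ball {F : Type*} [NormedAddCommGroup F]
    [SecondCountableTopologyEither (Euc n) F] {f : Euc n → F} (hf : Continuous f) (q : ℝ≥0∞) :
    MemLp f q (volume.restrict (ball (0 : Euc n) 1)) := by
  obtain ⟨C, hC⟩ := (isCompact_closedBall (0 : Euc n) 1).exists_bound_of_continuousOn
    hf.continuousOn
  have : IsFiniteMeasure (volume.restrict (ball (0 : Euc n) 1)) :=
    isFiniteMeasure_restrict.2 measure_ball_lt_top.ne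
  refine MemLp.of_bound hf.aestronglyMeasurable C ?_
  filter_upwards [ae_restrict_mem measurableSet_ball] with x hx
  exact hC x (ball_subset_closedBall hx)

/-- A classical gradient is a weak gradient. -/
theorem hasH1Gradient_of_hasFDerivAt {f : Euc n → ℝ} {X : Euc n → Euc n} (hX : Continuous X)
    (hf : ∀ x, HasFDerivAt f (innerBilin (Euc n) (X x)) x) :
    HasH1Gradient (ball (0 : Euc n) 1) f X := by
  have hfc : Continuous f := continuous_iff_continuousAt.2 fun x => (hf x).continuousAt
  refine ⟨hfc.memLp_restrict_ball 2, hX.memLp_restrict_ball 2, fun φ hφ hcs hsupp v => ?_⟩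
  have hφ1 : Continuous (fderiv ℝ φ) := hφ.continuous_fderiv (by simp)
  have hzero : ∀ x ∉ ball (0 : Euc n) 1, φ x = 0 ∧ fderiv ℝ φ x = 0 := fun x hx =>
    ⟨image_eq_zero_of_notMem_tsupport fun h => hx (hsupp h),
      image_eq_zero_of_notMem_tsupport fun h => hx (hsupp (tsupport_fderiv_subset ℝ h))⟩
  have hfd : ∀ x, fderiv ℝ f x v = inner ℝ (X x) v := fun x => by
    rw [(hf x).fderiv, innerBilin_apply]
  have hcs' : HasCompactSupport fun x => fderiv ℝ φ x v :=
    (hcs.fderiv ℝ).comp_left (g := fun L : Euc n →L[ℝ] ℝ => L v) (by simp)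
  rw [setIntegral_eq_integral_of_forall_compl_eq_zero (fun x hx => by simp [(hzero x hx).2]),
    setIntegral_eq_integral_of_forall_compl_eq_zero (fun x hx => by simp [(hzero x hx).1])]
  simp only [← hfd]
  refine integral_mul_fderiv_eq_neg_fderiv_mul_of_integrable ?_ ?_ ?_
    (fun x _ => (hf x).differentiableAt) fun x _ => (hφ.differentiable (by simp)) x
  · simp only [hfd]
    exact Continuous.integrable_of_hasCompactSupport
      ((hX.inner continuous_const).mul hφ.continuous) hcs.mul_left
  · exact Continuous.integrable_of_hasCompactSupport
      (hfc.mul (hφ1.clm_apply continuous_const)) hcs'.mul_left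
  · exact Continuous.integrable_of_hasCompactSupport (hfc.mul hφ.continuous) hcs.mul_left

theorem HasH1Gradient.congr_of_eqOn {Ω : Set (Euc n)} (hΩ : MeasurableSet Ω)
    {f g : Euc n → ℝ} {X : Euc n → Euc n} (hf : HasH1Gradient Ω f X) (hfg : EqOn g f Ω) :
    HasH1Gradient Ω g X := by
  refine ⟨?_, hf.memLp_grad, fun φ h1 h2 h3 v => ?_⟩
  · refine (memLp_congr_ae ?_).2 hf.memLp
    filter_upwards [ae_restrict_mem hΩ] with x hx
    exact hfg hx
  · rw [← hf.weak φ h1 h2 h3 v]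
    exact setIntegral_congr_fun hΩ fun x hx => by simp only [hfg hx]

end WeakGradient

/-! ### Selection of one family and convergence in norm -/

/-- If for every tolerance `ε` a witness exists eventually, then the witnesses can be chosen so
that a single family works for all tolerances. -/
theorem exists_uniform_selection {X : Type*} [Nonempty X] (Q : ℝ → ℝ → X → Prop)
    (hmono : ∀ p ε ε' x, ε ≤ ε' → Q p ε x → Q p ε' x)
    (hex : ∀ ε > 0, ∀ᶠ p : ℝ in atTop, ∃ x, Q p ε x) :
    ∃ x : ℝ → X, ∀ ε > 0, ∀ᶠ p : ℝ in atTop, Q p ε (x p) := by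
  set S : ℝ → Set ℝ := fun p => {ε | 0 < ε ∧ ∃ x, Q p ε x} with hS
  -- At each p take a witness within 1/p of the best available tolerance, which need not be
  -- attained.
  have key : ∀ p, ∃ x : X, 0 < p → (S p).Nonempty → Q p (sInf (S p) + 1 / p) x := by
    intro p
    by_cases h : 0 < p ∧ (S p).Nonempty
    · obtain ⟨hp, hne⟩ := h
      obtain ⟨ε, ⟨-, x, hx⟩, hlt⟩ := exists_lt_of_csInf_lt hne
        (lt_add_of_pos_right (sInf (S p)) (one_div_pos.2 hp))
      exact ⟨x, fun _ _ => hmono _ _ _ _ hlt.le hx⟩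
    · exact ⟨Classical.arbitrary X, fun hp hne => absurd ⟨hp, hne⟩ h⟩
  choose x hx using key
  refine ⟨x, fun ε hε => ?_⟩
  filter_upwards [hex (ε / 2) (by positivity), eventually_gt_atTop 0,
    eventually_ge_atTop (2 / ε)] with p h1 hp hp2
  have hmem : ε / 2 ∈ S p := ⟨by positivity, h1⟩
  have hle : sInf (S p) ≤ ε / 2 := csInf_le ⟨0, fun y hy => hy.1.le⟩ hmem
  have hle2 : 1 / p ≤ ε / 2 := by
    rw [div_le_iff₀ hp]
    rw [div_le_iff₀ hε] at hp2
    linarith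
  exact hmono _ _ _ _ (by linarith) (hx p hp ⟨_, hmem⟩)

theorem tendsto_eLpNorm_zero_of_uniform {α F ι : Type*} [MeasurableSpace α] {μ : Measure α}
    [IsFiniteMeasure μ] [NormedAddCommGroup F] {l : Filter ι} {f : ι → α → F} (q : ℝ≥0∞)
    (hf : ∀ ε > 0, ∀ᶠ i in l, ∀ᵐ x ∂μ, ‖f i x‖ ≤ ε) :
    Tendsto (fun i => eLpNorm (f i) q μ) l (𝓝 0) := by
  have hlim : Tendsto (fun ε : ℝ => μ univ ^ q.toReal⁻¹ * ENNReal.ofReal ε) (𝓝[>] 0) (𝓝 0) := by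
    have h1 : Tendsto (fun ε : ℝ => ENNReal.ofReal ε) (𝓝[>] 0) (𝓝 0) := by
      simpa using (ENNReal.continuous_ofReal.tendsto 0).mono_left nhdsWithin_le_nhds
    simpa using ENNReal.Tendsto.const_mul h1
      (Or.inr (ENNReal.rpow_ne_top_of_nonneg (by positivity) (measure_ne_top μ univ)))
  rw [ENNReal.tendsto_nhds_zero]
  intro δ hδ
  obtain ⟨ε, h1, h2⟩ := ((hlim.eventually (gt_mem_nhds hδ)).and self_mem_nhdsWithin).exists
  filter_upwards [hf ε h2] with i hi
  exact (eLpNorm_le_of_ae_bound hi).trans h1.le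

theorem tendsto_eLpNorm_two_zero_of_dominated {α F ι : Type*} [MeasurableSpace α]
    [MeasurableSpace F] [NormedAddCommGroup F] [OpensMeasurableSpace F] {μ : Measure α}
    [IsFiniteMeasure μ]
    {l : Filter ι} [l.IsCountablyGenerated] {f : ι → α → F} {B : ℝ}
    (hm : ∀ᶠ i in l, Measurable (f i)) (hB : ∀ᶠ i in l, ∀ᵐ x ∂μ, ‖f i x‖ ≤ B)
    (hlim : ∀ᵐ x ∂μ, Tendsto (fun i => f i x) l (𝓝 0)) :
    Tendsto (fun i => eLpNorm (f i) 2 μ) l (𝓝 0) := by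
  have h1 : Tendsto (fun i => ∫⁻ x, ‖f i x‖ₑ ^ (2 : ℝ) ∂μ) l (𝓝 (∫⁻ _, 0 ∂μ)) := by
    refine tendsto_lintegral_filter_of_dominated_convergence
      (fun _ => ENNReal.ofReal B ^ (2 : ℝ)) ?_ ?_ ?_ ?_
    · filter_upwards [hm] with i hi
      exact hi.enorm.pow_const _
    · filter_upwards [hB] with i hi
      filter_upwards [hi] with x hx
      gcongr
      rw [← ofReal_norm]
      exact ENNReal.ofReal_le_ofReal hx
    · rw [lintegral_const]
      exact ENNReal.mul_ne_top (ENNReal.rpow_ne_top_of_nonneg (by norm_num) ENNReal.ofReal_ne_top)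
        (measure_ne_top μ univ)
    · filter_upwards [hlim] with x hx
      have := ((ENNReal.continuous_rpow_const (y := 2)).tendsto _).comp hx.enorm
      simpa [Function.comp_def] using this
  rw [lintegral_zero] at h1
  have h2 := ((ENNReal.continuous_rpow_const (y := 1 / 2)).tendsto _).comp h1
  refine (h2.congr fun i => ?_).trans (by simp)
  rw [eLpNorm_eq_lintegral_rpow_enorm_toReal two_ne_zero ENNReal.ofNat_ne_top]
  simp

/-! ### Neumann solutions on the ball and conclusion -/

theorem IsShot.isNeumannSolution {d : ℕ} {V φ k u h : ℝ → ℝ} {p α : ℝ} (P : IsProfile d V φ k)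
    (S : IsShot d V φ p α u h) (hα : α ≤ 2) (h1 : radAvg d h 1 = 0)
    (hpos : ∀ r ∈ Icc (0 : ℝ) 1, 0 < u r) :
    IsNeumannSolution (d + 1) V p fun x => u ‖x‖ := by
  have hu : (fun x : Euc (d + 1) => u ‖x‖) = fun x => α * φ 0 + radPot d h ‖x‖ :=
    funext fun x => S.eq ‖x‖
  have hα0 : 0 ≤ α := by
    have e1 := hpos 0 ⟨le_rfl, zero_le_one⟩
    have e2 := S.le_mul P (r := 0) ⟨le_rfl, zero_le_one⟩
    exact (pos_of_mul_pos_left (e1.trans_le e2) P.zero_pos.le).le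
  have hmem : ∀ x ∈ ball (0 : Euc (d + 1)) 1, ‖x‖ ∈ Icc (0 : ℝ) 1 := fun x hx =>
    ⟨norm_nonneg _, (mem_ball_zero_iff.1 hx).le⟩
  refine ⟨?_, fun x hx => ?_, fun x hx => hpos _ (hmem x hx), fun x hx => ?_⟩
  · rw [hu]
    exact (contDiff_two_radPot_norm S.cont _).contDiffOn
  · rw [hu, laplacian_radPot_norm (by simp) S.cont]
    rw [S.source _ (hmem x hx), truncPow_eq (hpos _ (hmem x hx)).le
      ((S.le_of_nonneg P hα0 (hmem x hx)).trans hα)]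
    ring
  · have hx1 : ‖x‖ = 1 := mem_sphere_zero_iff_norm.1 hx
    have hud : UniqueDiffOn ℝ (closedBall (0 : Euc (d + 1)) 1) :=
      uniqueDiffOn_convex (convex_closedBall _ _)
        ⟨0, ball_subset_interior_closedBall (mem_ball_self one_pos)⟩
    rw [hu, (hasFDerivAt_radPot_norm S.cont _ x).hasFDerivWithinAt.fderivWithin
      (hud x (sphere_subset_closedBall hx)), innerBilin_apply, radField, hx1, h1, zero_smul,
      inner_zero_left]

theorem continuousOn_radial_of_contDiffOn {d : ℕ} {V : ℝ → ℝ}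
    (hV : ContDiffOn ℝ ∞ (fun x : Euc (d + 1) => V ‖x‖) (closedBall 0 1)) :
    ContinuousOn V (Icc 0 1) := by
  set e : Euc (d + 1) := EuclideanSpace.single 0 1 with he
  have hne : ‖e‖ = 1 := by simp [he]
  have h1 : ContinuousOn (fun r : ℝ => V ‖r • e‖) (Icc 0 1) := by
    refine hV.continuousOn.comp (f := fun r : ℝ => r • e) (by fun_prop) fun r hr => ?_
    rw [mem_closedBall_zero_iff, norm_smul, hne, mul_one, Real.norm_of_nonneg hr.1]
    exact hr.2
  refine h1.congr fun r hr => ?_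
  simp only [norm_smul, hne, mul_one, Real.norm_of_nonneg hr.1]

/-- The family of Neumann solutions converging to the profile `φ`. -/
theorem IsProfile.exists_solution_family {d : ℕ} {V φ k w : ℝ → ℝ} (P : IsProfile d V φ k)
    (hV : ContinuousOn V (Icc 0 1)) (hw : ∀ r ∈ Icc (0 : ℝ) 1, w r = φ r) :
    ∃ U : ℝ → ℝ → ℝ,
      (∀ᶠ p : ℝ in atTop, IsNeumannSolution (d + 1) V p (fun x => U p ‖x‖)) ∧
      TendstoInH1 (ball (0 : Euc (d + 1)) 1) atTop
        (fun (p : ℝ) (x : Euc (d + 1)) => U p ‖x‖) (fun x => w ‖x‖) ∧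
      TendstoInLinfty (ball (0 : Euc (d + 1)) 1) atTop
        (fun (p : ℝ) (x : Euc (d + 1)) => U p ‖x‖) (fun x => w ‖x‖) := by
  obtain ⟨B, hB⟩ := P.exists_neumann_shot hV
  obtain ⟨y, hy⟩ := exists_uniform_selection (X := (ℝ → ℝ) × (ℝ → ℝ))
    (fun p ε y => ∃ α, IsShot d V φ p α y.1 y.2 ∧ α ≤ 2 ∧
      radAvg d y.2 1 = 0 ∧ (∀ r ∈ Icc (0 : ℝ) 1, 0 < y.1 r ∧ |y.1 r - φ r| ≤ ε) ∧
      (∀ r ∈ Icc (0 : ℝ) 1, |r * radAvg d y.2 r - r * radAvg d k r| ≤ B) ∧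
      ∀ r ∈ Icc 0 (1 - ε), |r * radAvg d y.2 r - r * radAvg d k r| ≤ ε)
    (fun p ε ε' y hle ⟨α, h1, h2, h3, h4, h5, h6⟩ => ⟨α, h1, h2, h3,
      fun r hr => ⟨(h4 r hr).1, (h4 r hr).2.trans hle⟩, h5,
      fun r hr => (h6 r ⟨hr.1, hr.2.trans (by linarith)⟩).trans hle⟩)
    (fun ε hε => by
      filter_upwards [hB ε hε] with p hp
      obtain ⟨α, u, h, H⟩ := hp
      exact ⟨(u, h), α, H⟩)
  have hmem : ∀ x ∈ ball (0 : Euc (d + 1)) 1, ‖x‖ ∈ Icc (0 : ℝ) 1 := fun x hx =>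
    ⟨norm_nonneg _, (mem_ball_zero_iff.1 hx).le⟩
  have hball : ∀ᵐ x ∂(volume.restrict (ball (0 : Euc (d + 1)) 1)),
      x ∈ ball (0 : Euc (d + 1)) 1 := ae_restrict_mem measurableSet_ball
  have hfin : IsFiniteMeasure (volume.restrict (ball (0 : Euc (d + 1)) 1)) :=
    isFiniteMeasure_restrict.2 measure_ball_lt_top.ne
  have hwφ : EqOn (fun x : Euc (d + 1) => w ‖x‖) (fun x => φ ‖x‖) (ball 0 1) := fun x hx =>
    hw _ (hmem x hx)
  have hgrad : ∀ {u h : ℝ → ℝ} {c : ℝ}, Continuous h → (∀ r, u r = c + radPot d h r) →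
      HasH1Gradient (ball (0 : Euc (d + 1)) 1) (fun x => u ‖x‖) (radField d h) := by
    intro u h c hh hu
    have e : (fun x : Euc (d + 1) => u ‖x‖) = fun x => c + radPot d h ‖x‖ :=
      funext fun x => hu ‖x‖
    rw [e]
    exact hasH1Gradient_of_hasFDerivAt (continuous_radField hh) (hasFDerivAt_radPot_norm hh c)
  have hunif : ∀ ε > 0, ∀ᶠ p : ℝ in atTop,
      ∀ᵐ x ∂(volume.restrict (ball (0 : Euc (d + 1)) 1)),
        ‖(y p).1 ‖x‖ - w ‖x‖‖ ≤ ε := by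
    intro ε hε
    filter_upwards [hy ε hε] with p hp
    obtain ⟨α, -, -, -, h4, -⟩ := hp
    filter_upwards [hball] with x hx
    rw [hw _ (hmem x hx)]
    exact (h4 _ (hmem x hx)).2
  have hnorm : ∀ (h : ℝ → ℝ) (x : Euc (d + 1)),
      ‖radField d h x - radField d k x‖ = |‖x‖ * radAvg d h ‖x‖ - ‖x‖ * radAvg d k ‖x‖| := by
    intro h x
    rw [radField, radField, ← sub_smul, norm_smul, Real.norm_eq_abs, ← mul_sub, abs_mul, abs_norm,
      mul_comm]
  refine ⟨fun p => (y p).1, ?_, ⟨fun p => radField d (y p).2, radField d k, ?_, ?_, ?_, ?_⟩,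
    ?_, ?_, ?_⟩
  · filter_upwards [hy 1 one_pos] with p hp
    obtain ⟨α, S, hα, h1, h4, -⟩ := hp
    exact S.isNeumannSolution P hα h1 fun r hr => (h4 r hr).1
  · exact (hgrad P.cont P.eq).congr_of_eqOn measurableSet_ball hwφ
  · filter_upwards [hy 1 one_pos] with p hp
    obtain ⟨α, S, -⟩ := hp
    exact hgrad S.cont S.eq
  · exact tendsto_eLpNorm_zero_of_uniform 2 hunif
  · refine tendsto_eLpNorm_two_zero_of_dominated (B := B) ?_ ?_ ?_
    · filter_upwards [hy 1 one_pos] with p hp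
      obtain ⟨α, S, -⟩ := hp
      exact ((continuous_radField S.cont).sub (continuous_radField P.cont)).measurable
    · filter_upwards [hy 1 one_pos] with p hp
      obtain ⟨α, -, -, -, -, h5, -⟩ := hp
      filter_upwards [hball] with x hx
      rw [Pi.sub_apply, hnorm]
      exact h5 _ (hmem x hx)
    · filter_upwards [hball] with x hx
      rw [tendsto_zero_iff_norm_tendsto_zero, Metric.tendsto_nhds]
      intro ε hε
      have hx1 : ‖x‖ < 1 := mem_ball_zero_iff.1 hx
      -- Tolerance at most 1 - ‖x‖ places x in the region where the slopes are close; ε/2 gives the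
      -- strict inequality.
      have hδ : 0 < min (ε / 2) (1 - ‖x‖) := lt_min (by positivity) (by linarith)
      filter_upwards [hy _ hδ] with p hp
      obtain ⟨α, -, -, -, -, -, h6⟩ := hp
      have := h6 ‖x‖ ⟨norm_nonneg _, by linarith [min_le_right (ε / 2) (1 - ‖x‖)]⟩
      rw [Pi.sub_apply, hnorm, dist_zero_right, Real.norm_eq_abs, abs_abs]
      linarith [min_le_left (ε / 2) (1 - ‖x‖)]
  · refine (memLp_congr_ae ?_).2
      ((P.continuous.comp (continuous_norm (E := Euc (d + 1)))).memLp_restrict_ball ∞)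
    filter_upwards [hball] with x hx
    exact hwφ hx
  · filter_upwards [hy 1 one_pos] with p hp
    obtain ⟨α, S, -⟩ := hp
    exact (S.continuous.comp (continuous_norm (E := Euc (d + 1)))).memLp_restrict_ball ∞
  · exact tendsto_eLpNorm_zero_of_uniform ∞ hunif

theorem mainTheorem2 (n : ℕ) (hn : 2 ≤ n) (V : ℝ → ℝ)
    (hVsmooth : ContDiffOn ℝ ∞ (fun x : Euc n => V ‖x‖) (closedBall 0 1))
    (hVnonneg : ∀ r ∈ Icc (0 : ℝ) 1, 0 ≤ V r)
    (hVne : ∃ r ∈ Icc (0 : ℝ) 1, V r ≠ 0) :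
    (∃ G : ℝ → ℝ → ℝ, IsNeumannGreen n V G) ∧
    ∀ G : ℝ → ℝ → ℝ, IsNeumannGreen n V G →
      (∀ r ∈ Ioc (0 : ℝ) 1, 0 < G r r) ∧
      (∃ ℓ : ℝ, ℓ < 0 ∧ Tendsto (deriv (energyF n G)) (𝓝[<] 1) (𝓝 ℓ)) ∧
      IsLocalMinOn (energyF n G) (Ioc 0 1) 1 ∧
      ∃ U : ℝ → ℝ → ℝ,
        (∀ᶠ p : ℝ in atTop, IsNeumannSolution n V p (fun x => U p ‖x‖)) ∧
        TendstoInH1 (ball (0 : Euc n) 1) atTop (fun (p : ℝ) (x : Euc n) => U p ‖x‖)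
          (fun x => G ‖x‖ 1 / G 1 1) ∧
        TendstoInLinfty (ball (0 : Euc n) 1) atTop (fun (p : ℝ) (x : Euc n) => U p ‖x‖)
          (fun x => G ‖x‖ 1 / G 1 1) := by
  obtain ⟨d, rfl⟩ : ∃ d, n = d + 1 := ⟨n - 1, by omega⟩
  have hd : 1 ≤ d := by omega
  have hV := continuousOn_radial_of_contDiffOn hVsmooth
  obtain ⟨φ, k, P⟩ := exists_isProfile d hV hVnonneg hVne
  refine ⟨⟨_, P.isNeumannGreen_radialGreen hV⟩, fun G hG => ⟨fun r hr => P.green_diag_pos hd hG hr,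
    ⟨_, neg_neg_of_pos (mul_pos (sphereArea_pos d) (pow_pos P.slope_pos 2)),
      P.tendsto_deriv_energyF hd hG⟩, P.isLocalMinOn_energyF hd hG, ?_⟩⟩
  exact P.exists_solution_family hV (w := fun r => G r 1 / G 1 1) fun r hr =>
    P.green_one_div hd hG hr
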